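/- Let $d\ge 1$, $n\ge d+1$, and let $\xi_1,\dots,\xi_n$ be random vectors in $\mathbb R^d$ on a common probability space, with partial sums $S_i=\xi_1+\dots+\xi_i$, $1\le i\le n$. Assume: ($\pm$Ex) for every permutation $\sigma$ of $\{1,\dots,n\}$ and all $\varepsilon_1,\dots,\varepsilon_n\in\{-1,+1\}$, the tuples $(\xi_1,\dots,\xi_n)$ and $(\varepsilon_1\xi_{\sigma(1)},\dots,\varepsilon_n\xi_{\sigma(n)})$ have the same distribution; (GP) for all $1\le i_1<\dots<i_d\le n$, the vectors $S_{i_1},\dots,S_{i_d}$ are linearly dependent with probability $0$. For $1\le k\le m\le n$ put $$M_{m,k}^{(d)}=\frac12\sum_{1\le i_1<\dots<i_k\le m}\mathbf 1_{\{0\notin\mathrm{Conv}(S_{i_1},\dots,S_{i_k})\}},$$ where $\mathrm{Conv}$ is the convex hull, and define $B(k,j)$ by $(t+1)(t+3)\cdots(t+2k-1)=\sum_{j=0}^k B(k,j)t^j$, with $B(k,j)=0$ for $j<0$ and $j>k$. Then for every $k=1,\dots,n$, $$\mathbb E M_{n,k}^{(d)}=\binom nk\,\frac{B(k,d-1)+B(k,d-3)+\cdots}{2^k\,k!}=\binom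 nk\,\mathbb E M_{k,k}^{(d)}.$$ For $d=1$ this recovers the discrete arcsine law in the form of its factorial moments: if $N_n$ is the number of $i\in\{1,\dots,n\}$ with $S_i>0$, then $\mathbb E\binom{N_n}{k}=\frac1{2^{2k}}\binom{2k}{k}\binom nk$ for every $k=1,\dots,n$. -/

import Mathlib

namespace ArcsineLaw

open MeasureTheory ProbabilityTheory

noncomputable section

/-- The partial sums of a finite sequence of increments. The index is zero-based: for
`ξ = (ξ₁, …, ξₙ)`, the value at `i : Fin n` is `S_{i+1} = ξ₁ + … + ξ_{i+1}`. -/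
def walk {E : Type*} [AddCommMonoid E] {n : ℕ} (ξ : Fin n → E) (i : Fin n) : E :=
  ∑ j ∈ Finset.Iic i, ξ j

/-- Symmetric exchangeability (±Ex): the joint law of the increments is invariant under all
permutations and all changes of signs. -/
def SymmExchangeable {Ω : Type*} [MeasurableSpace Ω] (μ : Measure Ω) {n d : ℕ}
    (ξ : Fin n → Ω → EuclideanSpace ℝ (Fin d)) : Prop :=
  ∀ (σ : Equiv.Perm (Fin n)) (ε : Fin n → ℝ), (∀ i, ε i = -1 ∨ ε i = 1) →
    IdentDistrib (fun ω i => ξ i ω) (fun ω i => ε i • ξ (σ i) ω) μ μ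

/-- General position (GP): for all `i₁ < … < i_d`, the vectors `S_{i₁}, …, S_{i_d}` are linearly
dependent with probability zero. -/
def GeneralPosition {Ω : Type*} [MeasurableSpace Ω] (μ : Measure Ω) {n d : ℕ}
    (ξ : Fin n → Ω → EuclideanSpace ℝ (Fin d)) : Prop :=
  ∀ i : Fin d → Fin n, StrictMono i →
    μ {ω | ¬ LinearIndependent ℝ (fun l : Fin d => walk (fun j => ξ j ω) (i l))} = 0

open Classical in
/-- Half the number of `k`-element sets of indices `i₁ < … < i_k` such that the convex hull of
`x_{i₁}, …, x_{i_k}` does not contain the origin. -/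
def halfCount {d n : ℕ} (k : ℕ) (x : Fin n → EuclideanSpace ℝ (Fin d)) : ℝ :=
  (1 / 2 : ℝ) * ∑ I ∈ Finset.powersetCard k (Finset.univ : Finset (Fin n)),
    if (0 : EuclideanSpace ℝ (Fin d)) ∉ convexHull ℝ (x '' (I : Set (Fin n))) then (1 : ℝ) else 0

/-- The random variable `M_{n,k}^{(d)}` of the walk with increments `ξ₁, …, ξₙ`. -/
def M {Ω : Type*} {d n : ℕ} (k : ℕ) (ξ : Fin n → Ω → EuclideanSpace ℝ (Fin d)) (ω : Ω) : ℝ :=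
  halfCount k (walk (fun j => ξ j ω))

/-- The coefficient `B(k, j)` of `t ^ j` in `(t + 1)(t + 3) ⋯ (t + 2k - 1)`, and zero
for negative `j` (it vanishes for `j > k` by degree). -/
def B (k : ℕ) (j : ℤ) : ℕ :=
  if j < 0 then 0
  else (∏ i ∈ Finset.range k, (Polynomial.X + Polynomial.C (2 * i + 1) : Polynomial ℕ)).coeff
    j.toNat

/-- The sum `B(k, d-1) + B(k, d-3) + …`; every term with `m ≥ d` has a negative second index
and so vanishes. -/
def sumB (k d : ℕ) : ℕ :=
  ∑ m ∈ Finset.range d, B k ((d : ℤ) - 1 - 2 * (m : ℤ))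

/-- The number of positive terms of a finite real sequence. -/
def numPos {n : ℕ} (x : Fin n → ℝ) : ℕ :=
  (Finset.univ.filter (fun i => 0 < x i)).card

end

end ArcsineLaw

namespace ArcsineLaw

open Finset MeasureTheory ProbabilityTheory

/- The hull of `k` vectors avoids the origin exactly when their space of linear relations misses the
standard simplex. For a walk, Abel summation turns this space into the relations of the increments
and the simplex into a closed Weyl chamber of type `B`, so summing over all signed permutations of
the increments counts the chambers missed by a subspace in general position; by deletion and
restriction the number of chambers it meets is a sum of the coefficients of
`(t + 1)(t + 3) ⋯ (t + 2k - 1)`.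

For `S_{i₁}, …, S_{i_k}` the increments are the sums over consecutive blocks. A signed permutation
of the blocks lifts to one of `ξ₁, …, ξₙ`, which preserves the law but moves the indices
`i₁ < … < i_k`; for a fixed permutation of the blocks this is a bijection of the `k`-subsets, so
the sum over all `k`-subsets is unchanged by averaging over the signed permutations of blocks. -/

section Coefficients

theorem B_of_neg (k : ℕ) {j : ℤ} (hj : j < 0) : B k j = 0 := by simp [B, hj]

theorem B_natCast (k j : ℕ) :
    B k (j : ℤ) = (∏ i ∈ range k,
      (Polynomial.X + Polynomial.C (2 * i + 1) : Polynomial ℕ)).coeff j := by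
  simp [B]

theorem B_succ (k : ℕ) (j : ℤ) : B (k + 1) j = (2 * k + 1) * B k j + B k (j - 1) := by
  rcases lt_or_ge j 0 with hj | hj
  · rw [B_of_neg _ hj, B_of_neg _ hj, B_of_neg _ (by lia)]; simp
  obtain ⟨m, rfl⟩ := Int.eq_ofNat_of_zero_le hj
  rw [B_natCast, B_natCast, prod_range_succ, mul_add, Polynomial.coeff_add,
    Polynomial.coeff_mul_C]
  cases m with
  | zero =>
    rw [Polynomial.coeff_mul_X_zero, B_of_neg _ (by simp)]
    ring
  | succ m =>
    rw [Polynomial.coeff_mul_X, show ((m + 1 : ℕ) : ℤ) - 1 = m by simp, B_natCast]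
    ring

@[simp]
theorem sumB_zero_right (k : ℕ) : sumB k 0 = 0 := by simp [sumB]

theorem sumB_eq_sum_range_succ (k d : ℕ) :
    sumB k d = ∑ m ∈ range (d + 1), B k ((d : ℤ) - 1 - 2 * (m : ℤ)) := by
  rw [sum_range_succ, B_of_neg _ (by lia), add_zero, sumB]

theorem sumB_succ_succ (k d : ℕ) :
    sumB (k + 1) (d + 1) = (2 * k + 1) * sumB k (d + 1) + sumB k d := by
  rw [sumB_eq_sum_range_succ k d, sumB, sumB, mul_sum, ← sum_add_distrib]
  refine sum_congr rfl fun m _ => ?_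
  rw [B_succ]
  congr 2
  push_cast; ring

theorem sumB_add_two (k d : ℕ) : sumB k (d + 2) = B k (d + 1 : ℕ) + sumB k d := by
  rw [sumB_eq_sum_range_succ k d, sumB, sum_range_succ', add_comm]
  congr 1
  · congr 1; push_cast; ring
  · refine sum_congr rfl fun m _ => ?_
    congr 1; push_cast; ring

theorem sumB_zero_add_sumB_zero_succ (d : ℕ) : sumB 0 d + sumB 0 (d + 1) = 1 := by
  induction d with
  | zero => simp [sumB, B]
  | succ d ih =>
    rw [sumB_add_two, B_natCast, add_comm, add_assoc, ih]
    simp [Polynomial.coeff_one]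

theorem two_mul_sumB_of_le {k d : ℕ} (hk : 1 ≤ k) (hd : k ≤ d) :
    2 * sumB k d = 2 ^ k * k.factorial := by
  induction k, hk using Nat.le_induction generalizing d with
  | base =>
    obtain ⟨d, rfl⟩ := Nat.exists_eq_add_of_le' hd
    have h := sumB_zero_add_sumB_zero_succ d
    simp only [sumB_succ_succ, Nat.factorial_one]
    lia
  | succ k _ ih =>
    obtain ⟨d, rfl⟩ := Nat.exists_eq_add_of_le' (Nat.le_of_add_left_le hd)
    have h1 := ih (d := d + 1) (by lia)
    have h2 := ih (d := d) (by lia)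
    rw [sumB_succ_succ, Nat.factorial_succ, pow_succ]
    linear_combination (2 * k + 1) * h1 + h2

theorem sumB_one_mul_two_pow (k : ℕ) : sumB k 1 * 2 ^ k = k.factorial * k.centralBinom := by
  induction k with
  | zero => simp [sumB, B]
  | succ k ih =>
    rw [sumB_succ_succ, sumB_zero_right, Nat.factorial_succ, pow_succ]
    linear_combination 2 * (2 * k + 1) * ih - k.factorial * Nat.succ_mul_centralBinom_succ k

theorem sumB_one_div (k : ℕ) :
    (sumB k 1 : ℝ) / (2 ^ k * k.factorial) = 1 / 2 ^ (2 * k) * (2 * k).choose k := by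
  have h : (sumB k 1 : ℝ) * 2 ^ k = k.factorial * (2 * k).choose k := by
    exact_mod_cast sumB_one_mul_two_pow k
  rw [pow_mul', pow_two, one_div_mul_eq_div, div_eq_div_iff (by positivity) (by positivity)]
  linear_combination (2 ^ k) * h

end Coefficients

section Arrangements

open Filter Module Topology

variable {U : Type*} [AddCommGroup U] [Module ℝ U]

theorem sign_eq_of_convex {C : Set U} (hC : Convex ℝ C) {f : Dual ℝ U} (hf : ∀ u ∈ C, f u ≠ 0)
    {u v : U} (hu : u ∈ C) (hv : v ∈ C) : SignType.sign (f u) = SignType.sign (f v) := by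
  have himage : (f '' C).OrdConnected := (hC.linear_image f).ordConnected
  have hzero : (0 : ℝ) ∉ f '' C := fun ⟨w, hw, hw0⟩ => hf w hw hw0
  have hpos : ∀ u ∈ C, ∀ v ∈ C, 0 < f u → 0 < f v := by
    intro u hu v hv h
    by_contra! h'
    exact hzero (himage.out (Set.mem_image_of_mem f hv) (Set.mem_image_of_mem f hu) ⟨h', h.le⟩)
  rcases (hf u hu).lt_or_gt with h | h
  · have hv' : f v < 0 := (hf v hv).lt_or_gt.resolve_right fun h' => h.not_gt (hpos v hv u hu h')
    rw [sign_neg h, sign_neg hv']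
  · rw [sign_pos h, sign_pos (hpos u hu v hv h)]

/-- The sign vector of the point `u` with respect to the linear forms in `A`. -/
noncomputable def signs (A : List (Dual ℝ U)) (u : U) : List SignType :=
  A.map fun f => SignType.sign (f u)

theorem zero_notMem_signs {A : List (Dual ℝ U)} {u : U} :
    0 ∉ signs A u ↔ ∀ a ∈ A, a u ≠ 0 := by
  simp [signs]

theorem signs_eq_signs {A : List (Dual ℝ U)} {u v : U} :
    signs A u = signs A v ↔ ∀ a ∈ A, SignType.sign (a u) = SignType.sign (a v) :=
  List.map_inj_left

theorem convex_setOf_signs_eq (A : List (Dual ℝ U)) (v : U) :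
    Convex ℝ {u | signs A u = signs A v} := by
  have hA : {u | signs A u = signs A v} =
      ⋂ a ∈ A, a ⁻¹' (SignType.sign ⁻¹' {SignType.sign (a v)}) := by
    ext u; simp [signs_eq_signs]
  rw [hA]
  exact convex_iInter₂ fun a _ =>
    (Set.ordConnected_singleton.preimage_mono SignType.sign.monotone).convex.linear_preimage a

theorem eventually_signs_add_smul {A : List (Dual ℝ U)} {u : U} (hu : 0 ∉ signs A u) (v : U) :
    ∀ᶠ t : ℝ in 𝓝 0, signs A (u + t • v) = signs A u := by
  have hA : ∀ a ∈ A, ∀ᶠ t : ℝ in 𝓝 0,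
      SignType.sign (a (u + t • v)) = SignType.sign (a u) := by
    intro a ha
    have hcont : ContinuousAt (fun t : ℝ => a u + t * a v) 0 := by fun_prop
    rcases (zero_notMem_signs.1 hu a ha).lt_or_gt with h | h
    · filter_upwards [hcont.eventually_lt_const (by simpa using h)] with t ht
      rw [sign_neg h, sign_neg (by simpa using ht)]
    · filter_upwards [hcont.eventually_const_lt (by simpa using h)] with t ht
      rw [sign_pos h, sign_pos (by simpa using ht)]
  have hall := (eventually_all_finite A.finite_toSet).2 hA
  filter_upwards [hall] with t ht using signs_eq_signs.2 ht

/-- The regions cut out in `L` by the hyperplanes on which the forms in `A` vanish, each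
represented by its sign vector. -/
def regions (A : List (Dual ℝ U)) (L : Submodule ℝ U) : Set (List SignType) :=
  {s | 0 ∉ s ∧ ∃ u ∈ L, signs A u = s}

theorem finite_regions (A : List (Dual ℝ U)) (L : Submodule ℝ U) : (regions A L).Finite := by
  refine (List.finite_length_eq SignType A.length).subset ?_
  rintro _ ⟨-, u, -, rfl⟩
  simp [signs]

/-- The regions of `A` that reach, within `L`, the side of the hyperplane `f = 0` on which `f` has
sign `c`. -/
def sideRegions (c : SignType) (f : Dual ℝ U) (A : List (Dual ℝ U)) (L : Submodule ℝ U) :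
    Set (List SignType) :=
  {s | c :: s ∈ regions (f :: A) L}

theorem mem_sideRegions {c : SignType} {f : Dual ℝ U} {A : List (Dual ℝ U)} {L : Submodule ℝ U}
    {s : List SignType} :
    s ∈ sideRegions c f A L ↔
      c ≠ 0 ∧ 0 ∉ s ∧ ∃ u ∈ L, SignType.sign (f u) = c ∧ signs A u = s := by
  simp [sideRegions, regions, signs, eq_comm (a := (0 : SignType)), and_assoc]

theorem exists_mem_signs_eq_of_apply_eq_zero {A : List (Dual ℝ U)} {L : Submodule ℝ U} {u v : U}
    (hu : u ∈ L) (hv : v ∈ L) (hA : 0 ∉ signs A u) {f : Dual ℝ U} (hf : f u = 0) :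
    ∃ w ∈ L, SignType.sign (f w) = SignType.sign (f v) ∧ signs A w = signs A u := by
  obtain ⟨t, ht, ht0⟩ := (((eventually_signs_add_smul hA v).filter_mono nhdsWithin_le_nhds).and
    (self_mem_nhdsWithin (s := Set.Ioi 0))).exists
  refine ⟨u + t • v, L.add_mem hu (L.smul_mem t hv), ?_, ht⟩
  rw [map_add, map_smul, hf, zero_add, smul_eq_mul, sign_mul, sign_pos ht0, one_mul]

theorem regions_cons (f : Dual ℝ U) (A : List (Dual ℝ U)) (L : Submodule ℝ U) :
    regions (f :: A) L =
      List.cons 1 '' sideRegions 1 f A L ∪ List.cons (-1) '' sideRegions (-1) f A L := by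
  refine Set.Subset.antisymm ?_ (by rintro _ (⟨s, hs, rfl⟩ | ⟨s, hs, rfl⟩) <;> exact hs)
  rintro _ ⟨h0, u, hu, rfl⟩
  have hmem : signs A u ∈ sideRegions (SignType.sign (f u)) f A L := ⟨h0, u, hu, rfl⟩
  rcases (sign_ne_zero.1 (mem_sideRegions.1 hmem).1).lt_or_gt with h | h
  · exact Or.inr ⟨_, sign_neg h ▸ hmem, by simp [signs, h]⟩
  · exact Or.inl ⟨_, sign_pos h ▸ hmem, by simp [signs, h]⟩

theorem sideRegions_one_union_sideRegions_neg_one {f : Dual ℝ U} {L : Submodule ℝ U}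
    (hf : ∃ v ∈ L, f v ≠ 0) (A : List (Dual ℝ U)) :
    sideRegions 1 f A L ∪ sideRegions (-1) f A L = regions A L := by
  ext s
  simp only [Set.mem_union, mem_sideRegions]
  constructor
  · rintro (⟨-, hs, u, hu, -, h⟩ | ⟨-, hs, u, hu, -, h⟩) <;> exact ⟨hs, u, hu, h⟩
  · rintro ⟨hs, u, hu, rfl⟩
    obtain ⟨w, hw, hfw, hAw⟩ : ∃ w ∈ L, f w ≠ 0 ∧ signs A w = signs A u := by
      by_cases hfu : f u = 0
      · obtain ⟨v, hv, hfv⟩ := hf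
        obtain ⟨w, hw, hfw, hAw⟩ := exists_mem_signs_eq_of_apply_eq_zero hu hv hs hfu
        exact ⟨w, hw, sign_ne_zero.1 (hfw ▸ sign_ne_zero.2 hfv), hAw⟩
      · exact ⟨u, hu, hfu, rfl⟩
    rcases hfw.lt_or_gt with h | h
    · exact Or.inr ⟨by decide, hs, w, hw, sign_neg h, hAw⟩
    · exact Or.inl ⟨by decide, hs, w, hw, sign_pos h, hAw⟩

theorem sideRegions_one_inter_sideRegions_neg_one {f : Dual ℝ U} {L : Submodule ℝ U}
    (hf : ∃ v ∈ L, f v ≠ 0) (A : List (Dual ℝ U)) :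
    sideRegions 1 f A L ∩ sideRegions (-1) f A L = regions A (L ⊓ f.ker) := by
  ext s
  simp only [Set.mem_inter_iff, mem_sideRegions]
  constructor
  · rintro ⟨⟨-, hs, u, hu, hfu, rfl⟩, -, -, v, hv, hfv, hAv⟩
    by_contra hcon
    have hC : Convex ℝ ((L : Set U) ∩ {w | signs A w = signs A u}) :=
      L.convex.inter (convex_setOf_signs_eq A u)
    have huv := sign_eq_of_convex hC (f := f)
      (fun w hw hfw => hcon ⟨hs, w, ⟨hw.1, hfw⟩, hw.2⟩) ⟨hu, rfl⟩ ⟨hv, hAv⟩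
    rw [hfu, hfv] at huv
    exact absurd huv (by decide)
  · rintro ⟨hs, u, ⟨hu, hfu⟩, rfl⟩
    obtain ⟨v, hv, hfv⟩ : ∃ v ∈ L, 0 < f v := by
      obtain ⟨v, hv, hfv⟩ := hf
      rcases hfv.lt_or_gt with h | h
      · exact ⟨-v, L.neg_mem hv, by simpa using h⟩
      · exact ⟨v, hv, h⟩
    have hpos := exists_mem_signs_eq_of_apply_eq_zero hu hv hs hfu
    have hneg := exists_mem_signs_eq_of_apply_eq_zero hu (L.neg_mem hv) hs hfu
    rw [sign_pos hfv] at hpos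
    rw [map_neg, sign_neg (neg_lt_zero.2 hfv)] at hneg
    exact ⟨⟨by decide, hs, hpos⟩, by decide, hs, hneg⟩

theorem ncard_regions_cons {f : Dual ℝ U} {L : Submodule ℝ U} (hf : ∃ v ∈ L, f v ≠ 0)
    (A : List (Dual ℝ U)) :
    (regions (f :: A) L).ncard = (regions A L).ncard + (regions A (L ⊓ f.ker)).ncard := by
  have hunion := sideRegions_one_union_sideRegions_neg_one hf A
  have hfin : (sideRegions 1 f A L).Finite ∧ (sideRegions (-1) f A L).Finite :=
    Set.finite_union.1 (hunion ▸ finite_regions A L)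
  have hdisj : Disjoint (List.cons 1 '' sideRegions 1 f A L)
      (List.cons (-1) '' sideRegions (-1) f A L) := by
    rw [Set.disjoint_left]
    rintro _ ⟨s, -, rfl⟩ ⟨t, -, ht⟩
    exact absurd (List.cons_eq_cons.1 ht).1 (by decide)
  rw [regions_cons, Set.ncard_union_eq hdisj (hfin.1.image _) (hfin.2.image _),
    Set.ncard_image_of_injective _ List.cons_injective,
    Set.ncard_image_of_injective _ List.cons_injective, ← hunion,
    ← sideRegions_one_inter_sideRegions_neg_one hf,
    Set.ncard_union_add_ncard_inter _ _ hfin.1 hfin.2]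

theorem ncard_regions_append_of_redundant {F A : List (Dual ℝ U)} {L : Submodule ℝ U}
    (h : ∀ u ∈ L, 0 ∉ signs A u → 0 ∉ signs F u) :
    (regions (F ++ A) L).ncard = (regions A L).ncard := by
  have happend (u : U) : signs (F ++ A) u = signs F u ++ signs A u := List.map_append
  have hA : regions A L = List.drop F.length '' regions (F ++ A) L := by
    ext s
    constructor
    · rintro ⟨h0, u, hu, rfl⟩
      exact ⟨_, ⟨by simp [happend, h u hu h0, h0], u, hu, rfl⟩, by simp [signs]⟩
    · rintro ⟨_, ⟨h0, u, hu, rfl⟩, rfl⟩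
      rw [happend, List.mem_append, not_or] at h0
      exact ⟨by simpa [signs] using h0.2, u, hu, by simp [signs]⟩
  rw [hA, Set.InjOn.ncard_image]
  rintro _ ⟨h0, u, hu, rfl⟩ _ ⟨-, v, hv, rfl⟩ huv
  rw [happend, List.mem_append, not_or] at h0
  replace huv : signs A v = signs A u := by simpa [signs] using huv.symm
  have hC : Convex ℝ ((L : Set U) ∩ {w | signs A w = signs A u}) :=
    L.convex.inter (convex_setOf_signs_eq A u)
  have hF : signs F u = signs F v := signs_eq_signs.2 fun f hf =>
    sign_eq_of_convex hC (fun w hw => zero_notMem_signs.1 (h w hw.1 (hw.2 ▸ h0.2)) f hf)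
      ⟨hu, rfl⟩ ⟨hv, huv⟩
  rw [happend, happend, hF, huv]

theorem ncard_regions_append {F A : List (Dual ℝ U)} {L : Submodule ℝ U}
    (hF : ∀ f ∈ F, ∃ v ∈ L, f v ≠ 0)
    (hpair : ∀ u ∈ L, 0 ∉ signs A u → F.Pairwise fun f g => f u ≠ 0 ∨ g u ≠ 0) :
    (regions (F ++ A) L).ncard =
      (regions A L).ncard + (F.map fun f => (regions A (L ⊓ f.ker)).ncard).sum := by
  induction F with
  | nil => simp
  | cons f F ih =>
    have hrec := ih (fun g hg => hF g (List.mem_cons_of_mem f hg))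
      fun u hu hA => (hpair u hu hA).of_cons
    have hwall : (regions (F ++ A) (L ⊓ f.ker)).ncard = (regions A (L ⊓ f.ker)).ncard :=
      ncard_regions_append_of_redundant fun u hu hA => zero_notMem_signs.2 fun g hg =>
        ((List.pairwise_cons.1 (hpair u hu.1 hA)).1 g hg).resolve_left (not_not.2 hu.2)
    rw [List.cons_append, ncard_regions_cons (hF f List.mem_cons_self), hrec, hwall,
      List.map_cons, List.sum_cons]
    ring

end Arrangements

section TypeB

open Module

/-- The number of distinct nonzero absolute values of the entries of a list. -/
noncomputable def absCount (l : List ℝ) : ℕ :=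
  ((l.map abs).toFinset.erase 0).card

theorem absCount_cons_le (a : ℝ) (l : List ℝ) : absCount (a :: l) ≤ absCount l + 1 := by
  refine (card_le_card ?_).trans (card_insert_le |a| _)
  intro b
  simp only [List.map_cons, List.toFinset_cons, mem_erase, mem_insert]
  tauto

theorem absCount_cons_of_mem {a : ℝ} {l : List ℝ} (h : a = 0 ∨ |a| ∈ l.map abs) :
    absCount (a :: l) = absCount l := by
  unfold absCount
  congr 1
  ext b
  simp only [List.map_cons, List.toFinset_cons, mem_erase, mem_insert, List.mem_toFinset]
  rcases h with rfl | h
  · simp +contextual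
  · exact and_congr_right fun _ => or_iff_right_of_imp fun hb => hb ▸ h

theorem absCount_le_of_drop_eq_zero {l : List ℝ} {d : ℕ} (h : ∀ a ∈ l.drop d, a = 0) :
    absCount l ≤ d := by
  calc absCount l ≤ ((l.take d).map abs).toFinset.card := card_le_card fun b hb => by
        rw [mem_erase, List.mem_toFinset, ← List.take_append_drop d l, List.map_append,
          List.mem_append] at hb
        refine List.mem_toFinset.2 (hb.2.resolve_right fun hdrop => ?_)
        obtain ⟨a, ha, rfl⟩ := List.mem_map.1 hdrop
        exact hb.1 (by rw [h a ha, abs_zero])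
    _ ≤ ((l.take d).map abs).length := List.toFinset_card_le _
    _ ≤ d := by simp

theorem absCount_le_length (l : List ℝ) : absCount l ≤ l.length :=
  absCount_le_of_drop_eq_zero (by simp)

variable {U : Type*} [AddCommGroup U] [Module ℝ U]

theorem mem_ker_pi_get {fs : List (Dual ℝ U)} {u : U} :
    u ∈ (LinearMap.pi fs.get).ker ↔ ∀ f ∈ fs, f u = 0 := by
  simp [funext_iff, List.forall_mem_iff_getElem, Fin.forall_iff]

theorem finrank_le_finrank_inf_ker_add [FiniteDimensional ℝ U] {W : Type*} [AddCommGroup W]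
    [Module ℝ W] [FiniteDimensional ℝ W] (L : Submodule ℝ U) (φ : U →ₗ[ℝ] W) :
    finrank ℝ L ≤ finrank ℝ ↥(L ⊓ φ.ker) + finrank ℝ W := by
  have hker : (φ.domRestrict L).ker.map L.subtype = L ⊓ φ.ker := by
    ext u; simp [and_comm]
  rw [← hker, Submodule.finrank_map_subtype_eq, ← (φ.domRestrict L).finrank_range_add_finrank_ker,
    add_comm]
  exact Nat.add_le_add_left (Submodule.finrank_le _) _

theorem finrank_le_of_lt_absCount [FiniteDimensional ℝ U] {fs : List (Dual ℝ U)} {d : ℕ}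
    {L : Submodule ℝ U} (hL : ∀ u ∈ L, u ≠ 0 → d < absCount (fs.map (· u))) :
    finrank ℝ L ≤ fs.length - d := by
  have hbot : L ⊓ (LinearMap.pi (fs.drop d).get).ker = ⊥ := by
    refine (Submodule.eq_bot_iff _).2 fun u hu => of_not_not fun h0 => (hL u hu.1 h0).not_ge ?_
    refine absCount_le_of_drop_eq_zero fun a ha => ?_
    rw [← List.map_drop] at ha
    obtain ⟨f, hf, rfl⟩ := List.mem_map.1 ha
    exact mem_ker_pi_get.1 hu.2 f hf
  have hrank := finrank_le_finrank_inf_ker_add L (LinearMap.pi (fs.drop d).get)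
  rwa [hbot, finrank_bot, zero_add, finrank_fin_fun, List.length_drop] at hrank

/-- The forms `0`, `f`, `-f` for `f` in the list. -/
def signedForms (fs : List (Dual ℝ U)) : List (Dual ℝ U) :=
  0 :: (fs ++ fs.map (-·))

theorem length_signedForms (fs : List (Dual ℝ U)) :
    (signedForms fs).length = 2 * fs.length + 1 := by
  simp [signedForms, two_mul]

/-- The forms `f`, `f - g`, `f + g`, where `f` precedes `g` in the list: the pull-back of the
reflection arrangement of type `B` under the map with components in the list. -/
def typeB : List (Dual ℝ U) → List (Dual ℝ U)
  | [] => []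
  | f :: fs => (signedForms fs).map (f - ·) ++ typeB fs

theorem signs_typeB_congr {fs : List (Dual ℝ U)} {u v : U} (h : ∀ f ∈ fs, f u = f v) :
    signs (typeB fs) u = signs (typeB fs) v := by
  refine signs_eq_signs.2 fun a ha => congrArg _ ?_
  induction fs with
  | nil => simp [typeB] at ha
  | cons f fs ih =>
    have hfs : ∀ g ∈ fs, g u = g v := fun g hg => h g (List.mem_cons_of_mem f hg)
    rcases List.mem_append.1 ha with ha | ha
    · obtain ⟨φ, hφ, rfl⟩ := List.mem_map.1 ha
      have hφuv : φ u = φ v := by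
        simp only [signedForms, List.mem_cons, List.mem_append, List.mem_map] at hφ
        rcases hφ with rfl | hφ | ⟨g, hg, rfl⟩
        · rfl
        · exact hfs φ hφ
        · simp [hfs g hg]
      simp [hφuv, h f List.mem_cons_self]
    · exact ih hfs ha

theorem zero_notMem_signs_typeB {fs : List (Dual ℝ U)} {u : U} :
    0 ∉ signs (typeB fs) u ↔ (∀ f ∈ fs, f u ≠ 0) ∧ fs.Pairwise fun f g => |f u| ≠ |g u| := by
  induction fs with
  | nil => simp [typeB, signs]
  | cons f fs ih =>
    have hf : 0 ∉ signs ((signedForms fs).map (f - ·)) u ↔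
        f u ≠ 0 ∧ ∀ g ∈ fs, |f u| ≠ |g u| := by
      simp only [zero_notMem_signs, signedForms, List.forall_mem_map, List.forall_mem_cons,
        List.forall_mem_append, LinearMap.sub_apply, LinearMap.zero_apply, LinearMap.neg_apply,
        sub_ne_zero, ne_eq, abs_eq_abs, not_or, forall_and]
    rw [typeB, signs, List.map_append, List.mem_append, not_or, ← signs, ← signs, hf, ih,
      List.forall_mem_cons, List.pairwise_cons]
    tauto

theorem pairwise_signedForms {fs : List (Dual ℝ U)} {u : U} (hu : 0 ∉ signs (typeB fs) u) :
    (signedForms fs).Pairwise fun φ ψ => φ u ≠ ψ u := by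
  obtain ⟨h0, hfs⟩ := zero_notMem_signs_typeB.1 hu
  have hne : fs.Pairwise fun f g => f u ≠ g u := hfs.imp fun h h' => h (by rw [h'])
  have : Std.Symm fun f g : Dual ℝ U => f u ≠ -g u := ⟨fun f g h h' => h (by rw [h', neg_neg])⟩
  have hneg : ∀ f ∈ fs, ∀ g ∈ fs, f u ≠ -g u := fun f hf g hg =>
    List.Pairwise.forall_of_forall (R := fun f g => f u ≠ -g u)
      (fun f hf h => h0 f hf (self_eq_neg.1 h)) (hfs.imp fun h h' => h (by rw [h', abs_neg])) hf hg
  simp only [signedForms, List.pairwise_cons, List.pairwise_append, List.pairwise_map,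
    List.forall_mem_append, List.forall_mem_map, LinearMap.neg_apply, LinearMap.zero_apply,
    ne_eq, neg_inj, eq_comm (a := (0 : ℝ)), neg_eq_zero]
  exact ⟨⟨h0, h0⟩, hne, hne, hneg⟩

theorem absCount_map_cons_of_mem_signedForms {f φ : Dual ℝ U} {fs : List (Dual ℝ U)}
    (hφ : φ ∈ signedForms fs) {u : U} (hu : u ∈ (f - φ).ker) :
    absCount ((f :: fs).map (· u)) = absCount (fs.map (· u)) := by
  rw [LinearMap.mem_ker, LinearMap.sub_apply, sub_eq_zero] at hu
  simp only [signedForms, List.mem_cons, List.mem_append, List.mem_map] at hφ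
  rw [List.map_cons]
  refine absCount_cons_of_mem ?_
  rcases hφ with rfl | hφ | ⟨g, hg, rfl⟩
  · exact Or.inl hu
  · exact Or.inr (by simpa [hu] using ⟨φ, hφ, rfl⟩)
  · exact Or.inr (by simpa [hu] using ⟨g, hg, rfl⟩)

theorem ncard_regions_typeB_add_of_length_le {fs : List (Dual ℝ U)} {L : Submodule ℝ U} {d : ℕ}
    (hfs : fs ≠ []) (hd : fs.length ≤ d) (hL : ∀ u ∈ L, u ≠ 0 → d < absCount (fs.map (· u))) :
    (regions (typeB fs) L).ncard + 2 * sumB fs.length d = 2 ^ fs.length * fs.length.factorial := by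
  have hL0 : ∀ u ∈ L, u = 0 := fun u hu => of_not_not fun h0 =>
    (hL u hu h0).not_ge ((absCount_le_length _).trans (by simpa using hd))
  have hempty : regions (typeB fs) L = ∅ := by
    refine Set.eq_empty_of_forall_notMem ?_
    rintro _ ⟨h0, u, hu, rfl⟩
    rw [hL0 u hu, zero_notMem_signs_typeB] at h0
    exact h0.1 (fs.head hfs) (List.head_mem hfs) (map_zero _)
  rw [hempty, Set.ncard_empty, zero_add]
  exact two_mul_sumB_of_le (List.length_pos_iff.2 hfs) hd

theorem ncard_regions_typeB_cons {f : Dual ℝ U} {fs : List (Dual ℝ U)} {L : Submodule ℝ U}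
    (hf : ∀ φ ∈ signedForms fs, ∃ v ∈ L, (f - φ) v ≠ 0) :
    (regions (typeB (f :: fs)) L).ncard = (regions (typeB fs) L).ncard +
      ((signedForms fs).map fun φ => (regions (typeB fs) (L ⊓ (f - φ).ker)).ncard).sum := by
  rw [typeB, ncard_regions_append (by simpa only [List.forall_mem_map] using hf), List.map_map]
  · rfl
  · intro u _ hu
    refine List.pairwise_map.2 ((pairwise_signedForms hu).imp fun {φ ψ} h => ?_)
    by_contra! h'
    simp only [LinearMap.sub_apply, sub_eq_zero] at h'
    exact h (h'.1.symm.trans h'.2)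

theorem exists_sub_apply_ne_zero [FiniteDimensional ℝ U] {f φ : Dual ℝ U} {fs : List (Dual ℝ U)}
    {L : Submodule ℝ U} {d : ℕ} (hd : d ≤ fs.length) (hdim : fs.length + 1 ≤ finrank ℝ L + d)
    (hwall : ∀ u ∈ L ⊓ (f - φ).ker, u ≠ 0 → d < absCount (fs.map (· u))) :
    ∃ v ∈ L, (f - φ) v ≠ 0 := by
  by_contra! h
  have hrank := finrank_le_of_lt_absCount hwall
  rw [inf_eq_left.2 fun v hv => h v hv] at hrank
  lia

theorem exists_ne_zero_forall_apply_eq_zero [FiniteDimensional ℝ U] {fs : List (Dual ℝ U)}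
    {L : Submodule ℝ U} (h : fs.length < finrank ℝ L) :
    ∃ v ∈ L, v ≠ 0 ∧ ∀ g ∈ fs, g v = 0 := by
  have hrank := finrank_le_finrank_inf_ker_add L (LinearMap.pi fs.get)
  rw [finrank_fin_fun] at hrank
  have hbot : L ⊓ (LinearMap.pi fs.get).ker ≠ ⊥ := Submodule.one_le_finrank_iff.1 (by lia)
  obtain ⟨v, hv, hv0⟩ := Submodule.exists_mem_ne_zero_of_ne_bot hbot
  exact ⟨v, hv.1, hv0, mem_ker_pi_get.1 hv.2⟩

theorem regions_typeB_inf_ker [FiniteDimensional ℝ U] {f : Dual ℝ U} {fs : List (Dual ℝ U)}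
    {L : Submodule ℝ U} (hdim : fs.length < finrank ℝ L)
    (hL : ∀ u ∈ L, u ≠ 0 → 0 < absCount ((f :: fs).map (· u))) :
    regions (typeB fs) (L ⊓ f.ker) = regions (typeB fs) L := by
  obtain ⟨v, hv, hv0, hfs⟩ := exists_ne_zero_forall_apply_eq_zero hdim
  have hfv : f v ≠ 0 := fun hf => (hL v hv hv0).not_ge
    (absCount_le_of_drop_eq_zero (by simpa [hf] using hfs))
  ext s
  refine and_congr_right fun _ => ⟨fun ⟨u, hu, h⟩ => ⟨u, hu.1, h⟩, ?_⟩
  rintro ⟨u, hu, rfl⟩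
  exact ⟨u - (f u / f v) • v, ⟨L.sub_mem hu (L.smul_mem _ hv), by simp [hfv]⟩,
    signs_typeB_congr fun g hg => by simp [hfs g hg]⟩

theorem sum_map_add_length_mul {α : Type*} {l : List α} {w : α → ℕ} {b c : ℕ}
    (h : ∀ a ∈ l, w a + b = c) : (l.map w).sum + l.length * b = l.length * c := by
  have hsum : (l.map fun a => w a + b).sum = (l.map fun _ => c).sum := by
    rw [List.map_congr_left h]
  simpa [List.sum_map_add] using hsum

/- `hL` says that `L` is in general position with respect to the arrangement. Deletion of the
`2 * fs.length + 1` forms involving `f` keeps `L` and lowers `d`, restriction to any of them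
cuts `L` down and keeps `d`; this is the recursion `sumB_succ_succ`. -/
theorem ncard_regions_typeB_add [FiniteDimensional ℝ U] {fs : List (Dual ℝ U)} {L : Submodule ℝ U}
    {d : ℕ} (hd : d ≤ fs.length) (hdim : fs.length ≤ finrank ℝ L + d)
    (hL : ∀ u ∈ L, u ≠ 0 → d < absCount (fs.map (· u))) :
    (regions (typeB fs) L).ncard + 2 * sumB fs.length d = 2 ^ fs.length * fs.length.factorial := by
  induction fs generalizing L d with
  | nil =>
    obtain rfl : d = 0 := by simpa using hd
    have hregions : regions [] L = {[]} := Set.Subset.antisymm (fun _ ⟨_, _, _, h⟩ => h.symm)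
      (by simpa [regions, signs] using ⟨0, L.zero_mem⟩)
    simp [typeB, hregions]
  | cons f fs ih =>
    rcases hd.eq_or_lt with rfl | hd
    · exact ncard_regions_typeB_add_of_length_le (List.cons_ne_nil f fs) le_rfl hL
    rw [List.length_cons] at hd hdim ⊢
    replace hd : d ≤ fs.length := Nat.le_of_lt_succ hd
    have hwall : ∀ φ ∈ signedForms fs, ∀ u ∈ L ⊓ (f - φ).ker, u ≠ 0 →
        d < absCount (fs.map (· u)) := fun φ hφ u hu h0 =>
      absCount_map_cons_of_mem_signedForms hφ hu.2 ▸ hL u hu.1 h0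
    have hcount : ∀ φ ∈ signedForms fs, (regions (typeB fs) (L ⊓ (f - φ).ker)).ncard +
        2 * sumB fs.length d = 2 ^ fs.length * fs.length.factorial := fun φ hφ => by
      have hrank := finrank_le_finrank_inf_ker_add L (f - φ)
      rw [finrank_self] at hrank
      exact ih hd (by lia) (hwall φ hφ)
    have hsum := sum_map_add_length_mul hcount
    rw [length_signedForms] at hsum
    rw [ncard_regions_typeB_cons fun φ hφ => exists_sub_apply_ne_zero hd hdim (hwall φ hφ),
      pow_succ, Nat.factorial_succ]
    cases d with
    | zero =>
      have hzero := hcount 0 List.mem_cons_self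
      rw [sub_zero, regions_typeB_inf_ker hdim hL] at hzero
      rw [sumB_zero_right] at hsum hzero ⊢
      linear_combination hsum + hzero
    | succ e =>
      have hrest := ih (L := L) (d := e) (by lia) (by lia) fun u hu h0 =>
        Nat.lt_of_succ_lt_succ ((hL u hu h0).trans_le (absCount_cons_le _ _))
      rw [sumB_succ_succ]
      linear_combination hsum + hrest

end TypeB

section Chambers

open Module

/-- Signed permutations of `Fin k`, as pairs of a permutation and a choice of signs. -/
abbrev SignedPerm (k : ℕ) : Type :=
  Equiv.Perm (Fin k) × (Fin k → ℤˣ)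

theorem card_signedPerm (k : ℕ) : Fintype.card (SignedPerm k) = 2 ^ k * k.factorial := by
  rw [Fintype.card_prod, Fintype.card_perm, Fintype.card_fun, Fintype.card_fin,
    Fintype.card_units_int, mul_comm]

variable {E : Type*} [AddCommGroup E] [Module ℝ E] {k : ℕ}

/-- The action of a signed permutation on `k`-tuples: the tuple is permuted first, so that the
signs belong to positions. -/
def signedPerm (g : SignedPerm k) : (Fin k → E) →ₗ[ℝ] (Fin k → E) :=
  LinearMap.pi fun l => ((g.2 l : ℤ) : ℝ) • LinearMap.proj (g.1 l)

theorem signedPerm_apply (g : SignedPerm k) (x : Fin k → E) (l : Fin k) :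
    signedPerm g x l = ((g.2 l : ℤ) : ℝ) • x (g.1 l) := rfl

theorem abs_signedPerm (g : SignedPerm k) (z : Fin k → ℝ) (l : Fin k) :
    |signedPerm g z l| = |z (g.1 l)| := by
  rcases Int.units_eq_one_or (g.2 l) with h | h <;> simp [signedPerm_apply, h]

theorem sum_signedPerm_smul_signedPerm (g : SignedPerm k) (z : Fin k → ℝ) (x : Fin k → E) :
    ∑ l, signedPerm g z l • signedPerm g x l = ∑ l, z l • x l := by
  rw [← Equiv.sum_comp g.1 fun l => z l • x l]
  refine sum_congr rfl fun l _ => ?_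
  rcases Int.units_eq_one_or (g.2 l) with h | h <;> simp [signedPerm_apply, h]

theorem signedPerm_surjective (g : SignedPerm k) :
    Function.Surjective (signedPerm g : (Fin k → E) → Fin k → E) := by
  intro x
  refine ⟨fun l => ((g.2 (g.1.symm l) : ℤ) : ℝ) • x (g.1.symm l), funext fun l => ?_⟩
  rcases Int.units_eq_one_or (g.2 l) with h | h <;> simp [signedPerm_apply, h]

theorem exists_antitone_signedPerm (z : Fin k → ℝ) :
    ∃ g : SignedPerm k, Antitone (signedPerm g z) ∧ ∀ i, 0 ≤ signedPerm g z i := by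
  let σ : Equiv.Perm (Fin k) := Tuple.sort fun i => -|z i|
  let g : SignedPerm k := (σ, fun l => if 0 ≤ z (σ l) then 1 else -1)
  have hg : signedPerm g z = fun l => |z (σ l)| := by
    funext l
    rcases le_or_gt 0 (z (σ l)) with h | h
    · simp [g, signedPerm_apply, h, abs_of_nonneg h]
    · simp [g, signedPerm_apply, h.not_ge, abs_of_neg h]
  have hanti : Antitone fun l => |z (σ l)| := fun i j hij =>
    neg_le_neg_iff.1 (Tuple.monotone_sort (fun i => -|z i|) hij)
  exact ⟨g, hg ▸ hanti, fun i => hg ▸ abs_nonneg _⟩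

theorem signedPerm_eq_abs_comp {g : SignedPerm k} {z : Fin k → ℝ}
    (h : ∀ i, 0 ≤ signedPerm g z i) : signedPerm g z = (fun i => |z i|) ∘ g.1 :=
  funext fun l => by rw [Function.comp_apply, ← abs_signedPerm, abs_of_nonneg (h l)]

/-- The fundamental chamber `z₁ > z₂ > ⋯ > z_k > 0` of the reflection group of type `B`. -/
def fundamentalChamber (k : ℕ) : Set (Fin k → ℝ) :=
  {z | StrictAnti z ∧ ∀ i, 0 < z i}

theorem convex_fundamentalChamber (k : ℕ) : Convex ℝ (fundamentalChamber k) := by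
  rw [convex_iff_forall_pos]
  rintro z ⟨hz, hz0⟩ w ⟨hw, hw0⟩ a b ha hb -
  refine ⟨fun i j hij => ?_, fun i => add_pos (mul_pos ha (hz0 i)) (mul_pos hb (hw0 i))⟩
  exact add_lt_add (mul_lt_mul_of_pos_left (hz hij) ha) (mul_lt_mul_of_pos_left (hw hij) hb)

/-- The coordinate forms on `Fin k → ℝ`. -/
def coords (k : ℕ) : List (Dual ℝ (Fin k → ℝ)) :=
  List.ofFn fun i => LinearMap.proj i

theorem zero_notMem_signs_typeB_coords {z : Fin k → ℝ} :
    0 ∉ signs (typeB (coords k)) z ↔ (∀ i, z i ≠ 0) ∧ Function.Injective fun i => |z i| := by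
  rw [zero_notMem_signs_typeB, coords, List.forall_mem_ofFn_iff, List.pairwise_ofFn]
  refine and_congr_right fun _ => ⟨fun h i j hij => ?_, fun h i j hij => h.ne hij.ne⟩
  by_contra hne
  rcases lt_or_gt_of_ne hne with hlt | hlt
  · exact h hlt hij
  · exact h hlt hij.symm

theorem zero_notMem_signs_of_signedPerm_mem {g : SignedPerm k} {z : Fin k → ℝ}
    (h : signedPerm g z ∈ fundamentalChamber k) : 0 ∉ signs (typeB (coords k)) z := by
  rw [signedPerm_eq_abs_comp fun i => (h.2 i).le] at h
  refine zero_notMem_signs_typeB_coords.2 ⟨fun i => ?_, ?_⟩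
  · simpa using h.2 (g.1.symm i)
  · exact (Function.Injective.of_comp_iff' _ g.1.bijective).1 h.1.injective

theorem exists_signedPerm_mem_fundamentalChamber {z : Fin k → ℝ}
    (hz : 0 ∉ signs (typeB (coords k)) z) :
    ∃ g : SignedPerm k, signedPerm g z ∈ fundamentalChamber k := by
  obtain ⟨hz0, hinj⟩ := zero_notMem_signs_typeB_coords.1 hz
  obtain ⟨g, hanti, hnonneg⟩ := exists_antitone_signedPerm z
  refine ⟨g, hanti.strictAnti_of_injective ?_, fun l => (hnonneg l).lt_of_ne' ?_⟩
  · exact signedPerm_eq_abs_comp hnonneg ▸ hinj.comp g.1.injective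
  · exact abs_ne_zero.1 (abs_signedPerm g z l ▸ abs_ne_zero.2 (hz0 _))

theorem signedPerm_eq_of_mem_fundamentalChamber {g h : SignedPerm k} {z : Fin k → ℝ}
    (hg : signedPerm g z ∈ fundamentalChamber k) (hh : signedPerm h z ∈ fundamentalChamber k) :
    g = h := by
  obtain ⟨-, hinj⟩ := zero_notMem_signs_typeB_coords.1 (zero_notMem_signs_of_signedPerm_mem hg)
  have heq : (fun i => |z i|) ∘ g.1 = (fun i => |z i|) ∘ h.1 :=
    Tuple.unique_antitone (signedPerm_eq_abs_comp (fun i => (hg.2 i).le) ▸ hg.1.antitone)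
      (signedPerm_eq_abs_comp (fun i => (hh.2 i).le) ▸ hh.1.antitone)
  have hperm : g.1 = h.1 := Equiv.ext fun l => hinj (congrFun heq l)
  refine Prod.ext hperm (funext fun l => ?_)
  have h1 := hg.2 l
  have h2 := hh.2 l
  rw [signedPerm_apply, smul_eq_mul] at h1 h2
  by_contra hne
  rw [← hperm, Int.units_ne_iff_eq_neg.1 (Ne.symm hne), Units.val_neg, Int.cast_neg, neg_mul] at h2
  exact lt_asymm h1 (neg_pos.1 h2)

theorem signs_eq_of_signedPerm_mem {g : SignedPerm k} {z w : Fin k → ℝ}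
    (hz : signedPerm g z ∈ fundamentalChamber k) (hw : signedPerm g w ∈ fundamentalChamber k) :
    signs (typeB (coords k)) z = signs (typeB (coords k)) w :=
  signs_eq_signs.2 fun a ha =>
    sign_eq_of_convex ((convex_fundamentalChamber k).linear_preimage (signedPerm g))
      (fun _ hu => zero_notMem_signs.1 (zero_notMem_signs_of_signedPerm_mem hu) a ha) hz hw

theorem signedPerm_mem_of_signs_eq {g : SignedPerm k} {z w : Fin k → ℝ}
    (hz : signedPerm g z ∈ fundamentalChamber k)
    (hzw : signs (typeB (coords k)) z = signs (typeB (coords k)) w) :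
    signedPerm g w ∈ fundamentalChamber k := by
  have hw : 0 ∉ signs (typeB (coords k)) w := hzw ▸ zero_notMem_signs_of_signedPerm_mem hz
  have hpos (f : Dual ℝ (Fin k → ℝ)) (hf : ∀ u, 0 ∉ signs (typeB (coords k)) u → f u ≠ 0)
      (hfz : 0 < f z) : 0 < f w := by
    have hsign := sign_eq_of_convex (convex_setOf_signs_eq (typeB (coords k)) w)
      (fun u hu => hf u (hu ▸ hw)) hzw rfl
    rwa [sign_pos hfz, eq_comm, sign_eq_one_iff] at hsign
  constructor
  · intro i j hij
    refine sub_pos.1 (hpos (LinearMap.proj i ∘ₗ signedPerm g - LinearMap.proj j ∘ₗ signedPerm g)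
      (fun u hu h => ?_) (sub_pos.2 (hz.1 hij)))
    have habs : |signedPerm g u i| = |signedPerm g u j| := congrArg abs (sub_eq_zero.1 h)
    rw [abs_signedPerm, abs_signedPerm] at habs
    exact hij.ne (g.1.injective ((zero_notMem_signs_typeB_coords.1 hu).2 habs))
  · intro i
    refine hpos (LinearMap.proj i ∘ₗ signedPerm g) (fun u hu h => ?_) (hz.2 i)
    have habs : |signedPerm g u i| = 0 := abs_eq_zero.2 h
    rw [abs_signedPerm, abs_eq_zero] at habs
    exact (zero_notMem_signs_typeB_coords.1 hu).1 _ habs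

theorem ncard_setOf_exists_signedPerm_mem (L : Submodule ℝ (Fin k → ℝ)) :
    {g : SignedPerm k | ∃ z ∈ L, signedPerm g z ∈ fundamentalChamber k}.ncard =
      (regions (typeB (coords k)) L).ncard := by
  choose! z hzL hz using fun (g : SignedPerm k)
    (hg : ∃ z ∈ L, signedPerm g z ∈ fundamentalChamber k) => hg
  have himage : regions (typeB (coords k)) L = (fun g => signs (typeB (coords k)) (z g)) ''
      {g : SignedPerm k | ∃ z ∈ L, signedPerm g z ∈ fundamentalChamber k} := by
    refine Set.Subset.antisymm ?_ ?_
    · rintro _ ⟨h0, u, hu, rfl⟩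
      obtain ⟨g, hg⟩ := exists_signedPerm_mem_fundamentalChamber h0
      exact ⟨g, ⟨u, hu, hg⟩, signs_eq_of_signedPerm_mem (hz g ⟨u, hu, hg⟩) hg⟩
    · rintro _ ⟨g, hg, rfl⟩
      exact ⟨zero_notMem_signs_of_signedPerm_mem (hz g hg), z g, hzL g hg, rfl⟩
  rw [himage, Set.InjOn.ncard_image]
  intro g hg h hh hgh
  exact signedPerm_eq_of_mem_fundamentalChamber (signedPerm_mem_of_signs_eq (hz g hg) hgh) (hz h hh)

end Chambers

section ConvexHull

open Module

variable {ι V : Type*} [AddCommGroup V] [Module ℝ V]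

theorem span_image_eq_top_of_forall_linearIndepOn [FiniteDimensional ℝ V] {x : ι → V}
    {s : Finset ι} (hs : finrank ℝ V ≤ #s)
    (h : ∀ t : Finset ι, #t ≤ finrank ℝ V → LinearIndepOn ℝ x t) :
    Submodule.span ℝ (x '' s) = ⊤ := by
  obtain ⟨t, hts, ht⟩ := exists_subset_card_eq hs
  have htop : Submodule.span ℝ (x '' t) = ⊤ := by
    rw [Set.image_eq_range]
    exact LinearIndependent.span_eq_top_of_card_eq_finrank' (h t ht.le) (by simpa using ht)
  exact eq_top_mono (Submodule.span_mono (Set.image_mono (coe_subset.2 hts))) htop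

variable [Fintype ι]

theorem mem_convexHull_range_iff {x : ι → V} {v : V} :
    v ∈ convexHull ℝ (Set.range x) ↔ ∃ c ∈ stdSimplex ℝ ι, ∑ i, c i • x i = v := by
  classical
  have hx : Set.range x =
      Fintype.linearCombination ℝ x '' Set.range fun i : ι => Pi.single i (1 : ℝ) := by
    rw [← Set.range_comp]
    exact congrArg Set.range
      (funext fun i => by simp [Fintype.linearCombination_apply_single])
  rw [hx, ← LinearMap.image_convexHull, convexHull_rangle_single_eq_stdSimplex]
  simp only [Set.mem_image, Fintype.linearCombination_apply]

theorem exists_pos_sum_smul_eq_zero {x : ι → V} {c : ι → ℝ} (hc : ∀ i, 0 ≤ c i)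
    (hsum : ∑ i, c i • x i = 0) (hspan : Submodule.span ℝ (x '' {i | c i ≠ 0}) = ⊤) :
    ∃ c' : ι → ℝ, (∀ i, 0 < c' i) ∧ ∑ i, c' i • x i = 0 := by
  obtain ⟨b, hb⟩ : ∃ b : ι → ℝ, ∑ i with c i ≠ 0, b i • x i = -∑ i with c i = 0, x i := by
    refine (Submodule.mem_span_image_finset_iff_exists_fun' ℝ).1 ?_
    rw [coe_filter_univ, hspan]
    exact Submodule.mem_top
  obtain ⟨N, hN⟩ : ∃ N : ℝ, ∀ i, c i ≠ 0 → 0 < N * c i + b i := by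
    refine (Filter.eventually_all.2 fun i => ?_ : ∀ᶠ N : ℝ in Filter.atTop, _).exists
    refine Filter.eventually_imp_distrib_left.2 fun hi => ?_
    exact (Filter.tendsto_atTop_add_const_right _ _ (Filter.tendsto_id.atTop_mul_const
      ((hc i).lt_of_ne' hi))).eventually_gt_atTop 0
  refine ⟨fun i => if c i = 0 then 1 else N * c i + b i, fun i => ?_, ?_⟩
  · by_cases hi : c i = 0
    · simp [hi]
    · simpa [hi] using hN i hi
  · have hsupp : ∑ i with c i ≠ 0, c i • x i = 0 := by
      rw [← hsum, sum_filter_of_ne fun i _ hi => left_ne_zero_of_smul hi]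
    simp only [ite_smul, one_smul]
    rw [sum_ite]
    simp only [add_smul, mul_smul, sum_add_distrib, ← smul_sum, ← ne_eq, hsupp, hb, smul_zero,
      zero_add, add_neg_cancel]

theorem zero_mem_convexHull_range_iff_exists_pos [FiniteDimensional ℝ V] [Nonempty ι] {x : ι → V}
    (h : ∀ s : Finset ι, #s ≤ finrank ℝ V → LinearIndepOn ℝ x s) :
    0 ∈ convexHull ℝ (Set.range x) ↔
      ∃ c : ι → ℝ, (∀ i, 0 < c i) ∧ ∑ i, c i • x i = 0 := by
  constructor
  · rw [mem_convexHull_range_iff]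
    rintro ⟨c, ⟨hc0, hc1⟩, hsum⟩
    have hcard : finrank ℝ V < #{i | c i ≠ 0} := by
      by_contra! hle
      have hzero : ∀ i, c i = 0 := fun i => of_not_not fun hi => hi <|
        linearIndepOn_finset_iff.1 (h _ hle) c
          (by rwa [sum_filter_of_ne fun i _ hi => left_ne_zero_of_smul hi]) i (by simpa using hi)
      simp [hzero] at hc1
    refine exists_pos_sum_smul_eq_zero hc0 hsum ?_
    rw [← span_image_eq_top_of_forall_linearIndepOn hcard.le h, coe_filter_univ]
  · rintro ⟨c, hc, hsum⟩
    have hmem := centerMass_mem_convexHull univ (fun i _ => (hc i).le)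
      (sum_pos (fun i _ => hc i) univ_nonempty) fun i _ => Set.mem_range_self (f := x) i
    rwa [centerMass, hsum, smul_zero] at hmem

end ConvexHull

section Walk

variable {V : Type*} [AddCommGroup V] [Module ℝ V] {k : ℕ}

/-- The sums of the tails of a vector: they express a combination of the values of a walk as a
combination of its increments. -/
def tailSum (c : Fin k → ℝ) (j : Fin k) : ℝ :=
  ∑ i ∈ Ici j, c i

theorem sum_smul_walk (c : Fin k → ℝ) (η : Fin k → V) :
    ∑ i, c i • walk η i = ∑ j, tailSum c j • η j := by
  simp only [walk, tailSum, smul_sum, sum_smul]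
  rw [sum_comm' (t' := univ) (s' := fun j => Ici j)]
  simp

/-- The decrements of a vector, its last entry being followed by zero; the inverse of
`tailSum`. -/
noncomputable def decrement (z : Fin k → ℝ) (i : Fin k) : ℝ :=
  z i - if h : (i : ℕ) + 1 < k then z ⟨i + 1, h⟩ else 0

theorem tailSum_decrement (z : Fin k → ℝ) : tailSum (decrement z) = z := by
  let zz : ℕ → ℝ := fun m => if h : m < k then z ⟨m, h⟩ else 0
  funext j
  calc tailSum (decrement z) j = ∑ m ∈ Ico (j : ℕ) k, (zz m - zz (m + 1)) := by
        rw [tailSum, ← Fin.map_valEmbedding_Ici, sum_map]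
        exact sum_congr rfl fun i _ => by simp [zz, decrement]
    _ = zz j - zz k := by
        rw [← neg_inj, ← sum_neg_distrib]
        simpa only [neg_sub] using sum_Ico_sub zz j.2.le
    _ = z j := by simp [zz]

theorem decrement_pos {z : Fin k → ℝ} (hz : z ∈ fundamentalChamber k) (i : Fin k) :
    0 < decrement z i := by
  rw [decrement, sub_pos]
  split_ifs with h
  · exact hz.1 (Fin.mk_lt_mk.2 (Nat.lt_succ_self _))
  · exact hz.2 i

theorem lt_of_decrement_ne_zero {z : Fin k → ℝ} (hz : Antitone z) {i j : Fin k}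
    (hi : decrement z i ≠ 0) (hij : i < j) : z j < z i := by
  have hlt : (i : ℕ) + 1 < k := (Nat.succ_le_of_lt hij).trans_lt j.2
  rw [decrement, dif_pos hlt, sub_ne_zero] at hi
  calc z j ≤ z ⟨i + 1, hlt⟩ := hz (Fin.mk_le_mk.2 (Nat.succ_le_of_lt hij))
    _ < z i := (hz (Fin.mk_le_mk.2 (Nat.le_succ _))).lt_of_ne' hi

theorem ne_zero_of_decrement_ne_zero {z : Fin k → ℝ} (hz : Antitone z) (h0 : ∀ i, 0 ≤ z i)
    {i : Fin k} (hi : decrement z i ≠ 0) : z i ≠ 0 := by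
  contrapose hi
  rw [decrement, hi, zero_sub, neg_eq_zero]
  split_ifs with hlt
  · exact le_antisymm (hi ▸ hz (Fin.mk_le_mk.2 (Nat.le_succ _))) (h0 _)
  · rfl

theorem tailSum_mem_fundamentalChamber {c : Fin k → ℝ} (hc : ∀ i, 0 < c i) :
    tailSum c ∈ fundamentalChamber k := by
  refine ⟨fun i j hij => ?_, fun j => sum_pos (fun i _ => hc i) ⟨j, mem_Ici.2 le_rfl⟩⟩
  exact sum_lt_sum_of_subset (i := i) (Ici_subset_Ici.2 hij.le) (mem_Ici.2 le_rfl)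
    (by simpa using hij) (hc i) fun l _ _ => (hc l).le

theorem exists_pos_sum_smul_walk_eq_zero_iff {η : Fin k → V} :
    (∃ c : Fin k → ℝ, (∀ i, 0 < c i) ∧ ∑ i, c i • walk η i = 0) ↔
      ∃ z ∈ fundamentalChamber k, ∑ j, z j • η j = 0 := by
  constructor
  · rintro ⟨c, hc, hsum⟩
    exact ⟨tailSum c, tailSum_mem_fundamentalChamber hc, sum_smul_walk c η ▸ hsum⟩
  · rintro ⟨z, hz, hsum⟩
    exact ⟨decrement z, decrement_pos hz, by rwa [sum_smul_walk, tailSum_decrement]⟩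

end Walk

section Generic

open Module

variable {V : Type*} [AddCommGroup V] [Module ℝ V] {d k : ℕ} {η : Fin k → V}

/-- Increments are generic with respect to `d` when, after any signed permutation, any at most
`d` values of their walk are linearly independent. -/
def Generic (d : ℕ) (η : Fin k → V) : Prop :=
  ∀ (g : SignedPerm k) (s : Finset (Fin k)), #s ≤ d →
    LinearIndepOn ℝ (walk (signedPerm g η)) s

/-- The `k`-tuples of vectors whose convex hull avoids the origin. -/
def hullAvoiding (k : ℕ) (V : Type*) [AddCommGroup V] [Module ℝ V] : Set (Fin k → V) :=
  {x | 0 ∉ convexHull ℝ (Set.range x)}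

theorem card_decrement_ne_zero_le_absCount (g : SignedPerm k) {z : Fin k → ℝ}
    (hanti : Antitone (signedPerm g z)) (hnonneg : ∀ i, 0 ≤ signedPerm g z i) :
    #{i | decrement (signedPerm g z) i ≠ 0} ≤ absCount (List.ofFn z) := by
  refine card_le_card_of_injOn (signedPerm g z) (fun i hi => ?_) fun i hi j hj hij => ?_
  · rw [coe_filter_univ, Set.mem_ofPred] at hi
    refine mem_coe.2 (mem_erase.2 ⟨ne_zero_of_decrement_ne_zero hanti hnonneg hi, ?_⟩)
    rw [← abs_of_nonneg (hnonneg i), abs_signedPerm, List.mem_toFinset]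
    exact List.mem_map_of_mem ((List.mem_ofFn' _ _).2 ⟨g.1 i, rfl⟩)
  · rw [coe_filter_univ, Set.mem_ofPred] at hi hj
    rcases lt_trichotomy i j with hlt | heq | hlt
    · exact absurd hij (lt_of_decrement_ne_zero hanti hi hlt).ne'
    · exact heq
    · exact absurd hij (lt_of_decrement_ne_zero hanti hj hlt).ne

theorem Generic.lt_absCount (h : Generic d η) {z : Fin k → ℝ} (hz : ∑ j, z j • η j = 0)
    (h0 : z ≠ 0) : d < absCount (List.ofFn z) := by
  obtain ⟨g, hanti, hnonneg⟩ := exists_antitone_signedPerm z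
  refine lt_of_lt_of_le ?_ (card_decrement_ne_zero_le_absCount g hanti hnonneg)
  by_contra! hle
  have hrel : ∑ i, decrement (signedPerm g z) i • walk (signedPerm g η) i = 0 := by
    rw [sum_smul_walk, tailSum_decrement, sum_signedPerm_smul_signedPerm, hz]
  have hdec : decrement (signedPerm g z) = 0 := funext fun i => of_not_not fun hi => hi <|
    linearIndepOn_finset_iff.1 (h g _ hle) _
      (by rwa [sum_filter_of_ne fun i _ hi => left_ne_zero_of_smul hi]) i (by simpa using hi)
  refine h0 (funext fun j => ?_)
  have hj : signedPerm g z (g.1.symm j) = 0 := by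
    rw [← tailSum_decrement (signedPerm g z), hdec]
    exact sum_const_zero
  rwa [← abs_eq_zero, abs_signedPerm, g.1.apply_symm_apply, abs_eq_zero] at hj

variable [FiniteDimensional ℝ V]

theorem Generic.zero_mem_convexHull_iff [NeZero k] (h : Generic (finrank ℝ V) η)
    (g : SignedPerm k) :
    0 ∈ convexHull ℝ (Set.range (walk (signedPerm g η))) ↔
      ∃ z ∈ (Fintype.linearCombination ℝ η).ker, signedPerm g z ∈ fundamentalChamber k := by
  rw [zero_mem_convexHull_range_iff_exists_pos (h g), exists_pos_sum_smul_walk_eq_zero_iff,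
    (signedPerm_surjective g).exists]
  simp only [sum_signedPerm_smul_signedPerm, LinearMap.mem_ker, Fintype.linearCombination_apply,
    and_comm]

theorem Generic.ncard_regions_typeB_coords_add [NeZero k] (h : Generic (finrank ℝ V) η) :
    (regions (typeB (coords k)) (Fintype.linearCombination ℝ η).ker).ncard +
      2 * sumB k (finrank ℝ V) = 2 ^ k * k.factorial := by
  have hlen : (coords k).length = k := List.length_ofFn
  have hL : ∀ z ∈ (Fintype.linearCombination ℝ η).ker, z ≠ 0 →
      finrank ℝ V < absCount ((coords k).map (· z)) := by
    intro z hz h0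
    rw [LinearMap.mem_ker, Fintype.linearCombination_apply] at hz
    rw [coords, List.map_ofFn]
    exact h.lt_absCount hz h0
  rcases le_total (finrank ℝ V) k with hle | hle
  · have hrank := (Fintype.linearCombination ℝ η).finrank_range_add_finrank_ker
    have hrange := Submodule.finrank_le (Fintype.linearCombination ℝ η).range
    rw [finrank_fin_fun] at hrank
    simpa only [hlen] using ncard_regions_typeB_add (by rwa [hlen]) (by lia) hL
  · have hne : coords k ≠ [] := List.ne_nil_of_length_pos (hlen.symm ▸ Nat.pos_of_neZero k)
    simpa only [hlen] using ncard_regions_typeB_add_of_length_le hne (by rwa [hlen]) hL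

theorem Generic.ncard_setOf_walk_signedPerm_mem_hullAvoiding [NeZero k]
    (h : Generic (finrank ℝ V) η) :
    {g : SignedPerm k | walk (signedPerm g η) ∈ hullAvoiding k V}.ncard =
      2 * sumB k (finrank ℝ V) := by
  have hcompl := Set.ncard_add_ncard_compl
    {g : SignedPerm k | 0 ∈ convexHull ℝ (Set.range (walk (signedPerm g η)))}
  simp only [h.zero_mem_convexHull_iff] at hcompl
  rw [ncard_setOf_exists_signedPerm_mem, Nat.card_eq_fintype_card, card_signedPerm,
    ← h.ncard_regions_typeB_coords_add] at hcompl
  simp only [hullAvoiding, Set.mem_ofPred, h.zero_mem_convexHull_iff]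
  exact Nat.add_left_cancel hcompl

end Generic

section Blocks

variable {k n : ℕ}

/-- The indices `i 0 < i 1 < ⋯` cut `Fin n` into consecutive blocks, the `l`-th of which ends
at `i l`; `blockMap i j` is the block of `j`, or `⊤` when `j` comes after all of them. -/
noncomputable def blockMap (i : Fin k ↪o Fin n) (j : Fin n) : WithTop (Fin k) :=
  ({l | j ≤ i l} : Finset (Fin k)).inf fun l => (l : WithTop (Fin k))

theorem blockMap_le_iff {i : Fin k ↪o Fin n} {j : Fin n} {l : Fin k} :
    blockMap i j ≤ l ↔ j ≤ i l := by
  rw [blockMap, Finset.inf_le_iff (WithTop.coe_lt_top l)]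
  simp only [mem_filter, mem_univ, true_and, WithTop.coe_le_coe]
  exact ⟨fun ⟨m, hjm, hml⟩ => hjm.trans (i.monotone hml), fun h => ⟨l, h, le_rfl⟩⟩

theorem withTop_le_of_forall_le_coe {α : Type*} [Preorder α] {a b : WithTop α}
    (h : ∀ l : α, b ≤ l → a ≤ l) : a ≤ b := by
  cases b with
  | top => exact le_top
  | coe l => exact h l le_rfl

theorem blockMap_monotone (i : Fin k ↪o Fin n) : Monotone (blockMap i) := fun _ _ hj =>
  withTop_le_of_forall_le_coe fun _ hl => blockMap_le_iff.2 (hj.trans (blockMap_le_iff.1 hl))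

theorem blockMap_apply (i : Fin k ↪o Fin n) (l : Fin k) : blockMap i (i l) = l :=
  le_antisymm (blockMap_le_iff.2 le_rfl) <| withTop_le_of_forall_le_coe fun _ hm =>
    WithTop.coe_le_coe.2 (i.le_iff_le.1 (blockMap_le_iff.1 hm))

theorem blockMap_injective : Function.Injective (blockMap : (Fin k ↪o Fin n) → _) := by
  intro i i' h
  ext l : 1
  refine le_antisymm ?_ ?_
  · rw [← blockMap_le_iff, ← h, blockMap_le_iff]
  · rw [← blockMap_le_iff, h, blockMap_le_iff]

theorem exists_blockMap_eq {b : Fin n → WithTop (Fin k)} (hb : Monotone b)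
    (hs : ∀ l : Fin k, ∃ j, b j = l) : ∃ i : Fin k ↪o Fin n, blockMap i = b := by
  have hne (l : Fin k) : ({j | b j ≤ l} : Finset (Fin n)).Nonempty := by
    obtain ⟨j, hj⟩ := hs l
    exact ⟨j, by simp [hj]⟩
  let f : Fin k → Fin n := fun l => max' _ (hne l)
  have hf {j : Fin n} {l : Fin k} : j ≤ f l ↔ b j ≤ l :=
    ⟨fun h => (hb h).trans (mem_filter.1 (max'_mem _ (hne l))).2,
      fun h => le_max' _ j (by simpa using h)⟩
  have hmono : StrictMono f := by
    intro l m hlm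
    obtain ⟨j, hj⟩ := hs m
    refine lt_of_lt_of_le (not_le.1 fun h => ?_) (hf.2 hj.le)
    rw [hf, hj, WithTop.coe_le_coe] at h
    exact h.not_gt hlm
  refine ⟨OrderEmbedding.ofStrictMono f hmono, funext fun j => le_antisymm ?_ ?_⟩
  · exact withTop_le_of_forall_le_coe fun l hl => blockMap_le_iff.2 (hf.2 hl)
  · exact withTop_le_of_forall_le_coe fun l hl => hf.1 (blockMap_le_iff.1 hl)

theorem exists_permuteBlocks (τ : Equiv.Perm (Fin k)) (i : Fin k ↪o Fin n) :
    ∃ (i' : Fin k ↪o Fin n) (σ : Equiv.Perm (Fin n)),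
      ∀ j, blockMap i (σ j) = WithTop.map τ (blockMap i' j) := by
  let b : Fin n → WithTop (Fin k) := WithTop.map τ.symm ∘ blockMap i
  obtain ⟨i', hi'⟩ := exists_blockMap_eq (Tuple.monotone_sort b) fun l =>
    ⟨(Tuple.sort b).symm (i (τ l)), by simp [b, blockMap_apply]⟩
  exact ⟨i', Tuple.sort b, fun j => by simp [hi', b, WithTop.map_map]⟩

/-- The indices of the ends of the blocks of `i` after these blocks, without the remaining
indices, are permuted by `τ`. -/
noncomputable def permuteBlocks (τ : Equiv.Perm (Fin k)) (i : Fin k ↪o Fin n) :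
    Fin k ↪o Fin n :=
  (exists_permuteBlocks τ i).choose

theorem exists_blockMap_apply_perm_eq (τ : Equiv.Perm (Fin k)) (i : Fin k ↪o Fin n) :
    ∃ σ : Equiv.Perm (Fin n), ∀ j,
      blockMap i (σ j) = WithTop.map τ (blockMap (permuteBlocks τ i) j) :=
  (exists_permuteBlocks τ i).choose_spec

theorem permuteBlocks_bijective (τ : Equiv.Perm (Fin k)) :
    Function.Bijective (permuteBlocks τ : (Fin k ↪o Fin n) → Fin k ↪o Fin n) := by
  have : Finite (Fin k ↪o Fin n) := Finite.of_injective _ DFunLike.coe_injective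
  refine Finite.injective_iff_bijective.1 fun i₁ i₂ h => blockMap_injective ?_
  obtain ⟨σ₁, hσ₁⟩ := exists_blockMap_apply_perm_eq τ i₁
  obtain ⟨σ₂, hσ₂⟩ := exists_blockMap_apply_perm_eq τ i₂
  have hcomp : blockMap i₁ ∘ (σ₂.symm.trans σ₁) = blockMap i₂ := by
    funext j
    rw [Function.comp_apply, Equiv.trans_apply, hσ₁, h, ← hσ₂, Equiv.apply_symm_apply]
  rw [← hcomp]
  exact Tuple.unique_monotone (f := blockMap i₁) (σ := 1) (blockMap_monotone i₁)
    (hcomp ▸ blockMap_monotone i₂)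

/-- The sums of a family over the blocks that end at `i 0 < i 1 < ⋯`. -/
noncomputable def blockSum {V : Type*} [AddCommMonoid V] (i : Fin k ↪o Fin n) (x : Fin n → V)
    (l : Fin k) : V :=
  ∑ j with blockMap i j = l, x j

theorem walk_blockSum {V : Type*} [AddCommMonoid V] (i : Fin k ↪o Fin n) (x : Fin n → V) :
    walk (blockSum i x) = walk x ∘ i := by
  funext l
  have hblocks : Iic (i l) = (Iic l).biUnion fun m => {j | blockMap i j = m} := by
    ext j
    simp only [mem_Iic, mem_biUnion, mem_filter, mem_univ, true_and, ← blockMap_le_iff]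
    rw [WithTop.le_coe_iff]
    simp only [and_comm]
  have hdisjoint : (Iic l : Set (Fin k)).PairwiseDisjoint
      fun m => ({j | blockMap i j = m} : Finset (Fin n)) := fun a _ b _ hab =>
    disjoint_filter.2 fun j _ ha hb => hab (WithTop.coe_injective (ha.symm.trans hb))
  rw [Function.comp_apply, walk, walk, hblocks, sum_biUnion (by simpa using hdisjoint)]
  rfl

theorem blockSum_castLEOrderEmb {V : Type*} [AddCommMonoid V] (hkn : k ≤ n) (x : Fin n → V) :
    blockSum (Fin.castLEOrderEmb hkn) x = x ∘ Fin.castLE hkn := by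
  funext l
  have hblock : ({j | blockMap (Fin.castLEOrderEmb hkn) j = l} : Finset (Fin n)) =
      {Fin.castLE hkn l} := by
    ext j
    rw [mem_filter_univ, mem_singleton]
    constructor
    · intro h
      have hjl : j ≤ Fin.castLE hkn l := blockMap_le_iff.1 h.le
      obtain ⟨m, rfl⟩ : ∃ m, Fin.castLE hkn m = j := ⟨⟨j, (Fin.le_def.1 hjl).trans_lt l.2⟩, rfl⟩
      rw [← Fin.castLEOrderEmb_apply, blockMap_apply] at h
      rw [WithTop.coe_injective h]
    · rintro rfl
      exact blockMap_apply (Fin.castLEOrderEmb hkn) l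
  rw [blockSum, hblock, sum_singleton, Function.comp_apply]

variable {V : Type*} [AddCommGroup V] [Module ℝ V]

theorem exists_walk_signedPerm_blockSum (g : SignedPerm k) (i : Fin k ↪o Fin n) :
    ∃ g' : SignedPerm n, ∀ x : Fin n → V,
      walk (signedPerm g (blockSum i x)) = walk (signedPerm g' x) ∘ permuteBlocks g.1 i := by
  obtain ⟨σ, hσ⟩ := exists_blockMap_apply_perm_eq g.1 i
  let δ : Fin n → ℤˣ := fun j => (blockMap (permuteBlocks g.1 i) j).recTopCoe 1 g.2
  refine ⟨(σ, δ), fun x => ?_⟩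
  rw [← walk_blockSum]
  congr 1
  funext l
  rw [signedPerm_apply, blockSum, blockSum, smul_sum]
  symm
  refine sum_equiv σ (fun j => ?_) fun j hj => ?_
  · rw [mem_filter_univ, mem_filter_univ, hσ, ← WithTop.map_coe,
      (WithTop.map_injective g.1.injective).eq_iff]
  · rw [mem_filter_univ] at hj
    simp only [signedPerm_apply, δ, hj, WithTop.recTopCoe_coe]

theorem Generic.blockSum {d : ℕ} {x : Fin n → V} (h : Generic d x) (i : Fin k ↪o Fin n) :
    Generic d (blockSum i x) := by
  intro g s hs
  obtain ⟨g', hg'⟩ := exists_walk_signedPerm_blockSum (V := V) g i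
  rw [hg']
  refine LinearIndepOn.comp_of_image ?_ (permuteBlocks g.1 i).injective.injOn
  rw [← coe_image]
  exact h g' _ (card_image_le.trans hs)

theorem Generic.castLE {d : ℕ} {x : Fin n → V} (h : Generic d x) (hkn : k ≤ n) :
    Generic d (x ∘ Fin.castLE hkn) :=
  blockSum_castLEOrderEmb hkn x ▸ h.blockSum _

end Blocks

section Law

theorem continuous_walk {V : Type*} [AddCommMonoid V] [TopologicalSpace V] [ContinuousAdd V]
    {n : ℕ} : Continuous (walk : (Fin n → V) → Fin n → V) := by
  unfold walk
  fun_prop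

theorem isOpen_hullAvoiding {V : Type*} [NormedAddCommGroup V] [NormedSpace ℝ V] {k : ℕ} :
    IsOpen (hullAvoiding k V) := by
  have hcompl : (hullAvoiding k V)ᶜ =
      Prod.snd '' {p : stdSimplex ℝ (Fin k) × (Fin k → V) | ∑ i, p.1.1 i • p.2 i = 0} := by
    ext x
    simp only [hullAvoiding, Set.mem_compl_iff, Set.mem_ofPred_eq, not_not,
      mem_convexHull_range_iff, Set.mem_image, Prod.exists, Subtype.exists, exists_eq_right,
      exists_prop]
  rw [← isClosed_compl_iff, hcompl]
  refine isClosedMap_snd_of_compactSpace _ (isClosed_eq ?_ continuous_const)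
  refine continuous_finsetSum _ fun i _ => Continuous.smul ?_ ?_
  · exact (continuous_apply i).comp (continuous_subtype_val.comp continuous_fst)
  · exact (continuous_apply i).comp continuous_snd

variable {Ω : Type*} [MeasurableSpace Ω] {μ : Measure Ω} {d n k : ℕ}
  {ξ : Fin n → Ω → EuclideanSpace ℝ (Fin d)}

theorem SymmExchangeable.identDistrib_signedPerm (hEx : SymmExchangeable μ ξ)
    (g : SignedPerm n) :
    IdentDistrib (fun ω i => ξ i ω) (fun ω => signedPerm g fun i => ξ i ω) μ μ :=
  hEx g.1 (fun i => ((g.2 i : ℤ) : ℝ)) fun i => by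
    rcases Int.units_eq_one_or (g.2 i) with h | h <;> simp [h]

theorem SymmExchangeable.castLE (hEx : SymmExchangeable μ ξ) (hkn : k ≤ n) :
    SymmExchangeable μ fun i : Fin k => ξ (Fin.castLE hkn i) := by
  intro σ ε hε
  have hlaw := hEx (σ.viaFintypeEmbedding (Fin.castLEEmb hkn))
    (fun j => if hj : (j : ℕ) < k then ε ⟨j, hj⟩ else 1) fun j => by
      split_ifs
      · exact hε _
      · exact Or.inr rfl
  have hval (l : Fin k) :
      σ.viaFintypeEmbedding (Fin.castLEEmb hkn) (Fin.castLE hkn l) = Fin.castLE hkn (σ l) :=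
    Equiv.Perm.viaFintypeEmbedding_apply_image σ (Fin.castLEEmb hkn) l
  simpa [Function.comp_def, hval] using hlaw.comp (u := fun x (l : Fin k) => x (Fin.castLE hkn l))
    (measurable_pi_iff.2 fun l => measurable_pi_apply _)

theorem GeneralPosition.ae_linearIndepOn (hGP : GeneralPosition μ ξ) {s : Finset (Fin n)}
    (hs : #s = d) : ∀ᵐ ω ∂μ, LinearIndepOn ℝ (walk fun j => ξ j ω) s := by
  filter_upwards [ae_iff.2 (hGP _ (s.orderEmbOfFin hs).strictMono)] with ω hω
  rw [← range_orderEmbOfFin s hs]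
  exact (linearIndepOn_range_iff (s.orderEmbOfFin hs).injective _).2 hω

theorem ae_generic (hdn : d ≤ n) (hEx : SymmExchangeable μ ξ) (hGP : GeneralPosition μ ξ) :
    ∀ᵐ ω ∂μ, Generic d fun j => ξ j ω := by
  have hmeas (t : Finset (Fin n)) : MeasurableSet
      {x : Fin n → EuclideanSpace ℝ (Fin d) | LinearIndepOn ℝ (walk x) t} :=
    (isOpen_setOfPred_linearIndependent.preimage (continuous_pi fun j : t =>
      (continuous_apply (j : Fin n)).comp continuous_walk)).measurableSet
  have hae : ∀ᵐ ω ∂μ, ∀ (g : SignedPerm n) (t : Finset (Fin n)), #t = d →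
      LinearIndepOn ℝ (walk (signedPerm g fun j => ξ j ω)) t := by
    refine ae_all_iff.2 fun g => ae_all_iff.2 fun t => ?_
    refine Filter.eventually_imp_distrib_left.2 fun ht => ?_
    exact (hEx.identDistrib_signedPerm g).ae_snd (hmeas t) (hGP.ae_linearIndepOn ht)
  filter_upwards [hae] with ω hω g s hs
  obtain ⟨t, hst, ht⟩ := exists_superset_card_eq hs (by simpa using hdn)
  exact (hω g t ht).mono (coe_subset.2 hst)

end Law

section Expectation

variable {n k : ℕ}

theorem card_orderEmb : Fintype.card (Fin k ↪o Fin n) = n.choose k := by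
  rw [← Nat.card_eq_fintype_card, Nat.card_congr Set.powersetCard.ofFinEmbEquiv,
    Set.powersetCard.card, Nat.card_fin]

theorem sum_powersetCard_eq_sum_orderEmb {R : Type*} [AddCommMonoid R] (f : Set (Fin n) → R) :
    ∑ I ∈ powersetCard k (univ : Finset (Fin n)), f I =
      ∑ i : Fin k ↪o Fin n, f (Set.range i) := by
  rw [sum_subtype _ (p := (· ∈ Set.powersetCard (Fin n) k)) (fun I => by simp) fun I => f I,
    ← Set.powersetCard.ofFinEmbEquiv.sum_comp]
  refine sum_congr rfl fun i _ => congrArg f (Set.ext fun j => ?_)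
  exact Set.powersetCard.mem_ofFinEmbEquiv_iff_mem_range i j

variable {Ω : Type*} {d : ℕ} {ξ : Fin n → Ω → EuclideanSpace ℝ (Fin d)}

theorem M_eq_sum_indicator (ω : Ω) :
    M k ξ ω = 1 / 2 * ∑ i : Fin k ↪o Fin n,
      {ω | walk (fun j => ξ j ω) ∘ i ∈ hullAvoiding k _}.indicator (1 : Ω → ℝ) ω := by
  classical
  rw [M, halfCount, sum_powersetCard_eq_sum_orderEmb fun I =>
    if 0 ∉ convexHull ℝ (walk (fun j => ξ j ω) '' I) then (1 : ℝ) else 0]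
  refine congrArg _ (sum_congr rfl fun i _ => ?_)
  rw [Set.indicator_apply, ← Set.range_comp]
  exact if_congr Iff.rfl rfl rfl

variable [MeasurableSpace Ω] {μ : Measure Ω}

/-- The probability that the convex hull of the walk at the given indices avoids the origin. -/
noncomputable def avoidProb (μ : Measure Ω) (ξ : Fin n → Ω → EuclideanSpace ℝ (Fin d))
    (i : Fin k ↪o Fin n) : ℝ :=
  μ.real {ω | walk (fun j => ξ j ω) ∘ i ∈ hullAvoiding k (EuclideanSpace ℝ (Fin d))}

theorem measurableSet_walk_comp_mem_hullAvoiding (i : Fin k ↪o Fin n) :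
    MeasurableSet {x | walk x ∘ i ∈ hullAvoiding k (EuclideanSpace ℝ (Fin d))} :=
  (isOpen_hullAvoiding.preimage
    (continuous_pi fun l => (continuous_apply (i l)).comp continuous_walk)).measurableSet

theorem SymmExchangeable.avoidProb_permuteBlocks (hEx : SymmExchangeable μ ξ)
    (g : SignedPerm k) (i : Fin k ↪o Fin n) :
    avoidProb μ ξ (permuteBlocks g.1 i) =
      μ.real {ω | walk (signedPerm g (blockSum i fun j => ξ j ω)) ∈ hullAvoiding k _} := by
  obtain ⟨g', hg'⟩ := exists_walk_signedPerm_blockSum (V := EuclideanSpace ℝ (Fin d)) g i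
  simp only [hg']
  exact congrArg ENNReal.toReal ((hEx.identDistrib_signedPerm g').measure_mem_eq
    (measurableSet_walk_comp_mem_hullAvoiding (permuteBlocks g.1 i)))

variable [IsProbabilityMeasure μ]

theorem integral_M_eq_sum_avoidProb (hξ : ∀ i, Measurable (ξ i)) :
    ∫ ω, M k ξ ω ∂μ = 1 / 2 * ∑ i : Fin k ↪o Fin n, avoidProb μ ξ i := by
  have hmeas (i : Fin k ↪o Fin n) :
      MeasurableSet {ω | walk (fun j => ξ j ω) ∘ i ∈ hullAvoiding k _} :=
    measurable_pi_iff.2 hξ (measurableSet_walk_comp_mem_hullAvoiding i)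
  simp only [M_eq_sum_indicator]
  rw [integral_const_mul, integral_finsetSum _ fun i _ =>
    (integrable_indicator_iff (hmeas i)).2 (integrable_const 1).integrableOn]
  simp only [integral_indicator_one (hmeas _), avoidProb]

theorem sum_measureReal_eq_of_ae_ncard_eq {ι : Type*} [Fintype ι] {s : ι → Set Ω}
    (hs : ∀ i, NullMeasurableSet (s i) μ) {m : ℕ} (h : ∀ᵐ ω ∂μ, {i | ω ∈ s i}.ncard = m) :
    ∑ i, μ.real (s i) = m := by
  classical
  have hsum : ∀ᵐ ω ∂μ, ∑ i, (s i).indicator (1 : Ω → ℝ) ω = m := by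
    filter_upwards [h] with ω hω
    simp only [Set.indicator_apply, Pi.one_apply]
    rw [sum_boole, ← hω, Set.ncard_eq_toFinset_card', Set.toFinset_ofPred]
  calc ∑ i, μ.real (s i) = ∑ i, ∫ ω, (s i).indicator (1 : Ω → ℝ) ω ∂μ :=
        sum_congr rfl fun i _ => by
          rw [integral_indicator₀ (hs i)]
          simp
    _ = ∫ ω, ∑ i, (s i).indicator (1 : Ω → ℝ) ω ∂μ :=
        (integral_finsetSum _ fun i _ =>
          (integrable_const (1 : ℝ)).indicator₀ (hs i)).symm
    _ = m := by
        rw [integral_congr_ae hsum]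
        simp

theorem sum_avoidProb_permuteBlocks [NeZero k] (hξ : ∀ i, Measurable (ξ i))
    (hEx : SymmExchangeable μ ξ) (hgen : ∀ᵐ ω ∂μ, Generic d fun j => ξ j ω)
    (i : Fin k ↪o Fin n) :
    ∑ g : SignedPerm k, avoidProb μ ξ (permuteBlocks g.1 i) = 2 * sumB k d := by
  simp only [hEx.avoidProb_permuteBlocks]
  have hmeas (g : SignedPerm k) : MeasurableSet
      {ω | walk (signedPerm g (blockSum i fun j => ξ j ω)) ∈ hullAvoiding k _} := by
    have hcont : Continuous fun x : Fin n → EuclideanSpace ℝ (Fin d) =>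
        walk (signedPerm g (blockSum i x)) := by
      unfold blockSum
      exact continuous_walk.comp ((LinearMap.continuous_of_finiteDimensional _).comp (by fun_prop))
    exact measurable_pi_iff.2 hξ (isOpen_hullAvoiding.preimage hcont).measurableSet
  have hcount : ∀ᵐ ω ∂μ, {g : SignedPerm k |
      walk (signedPerm g (blockSum i fun j => ξ j ω)) ∈ hullAvoiding k _}.ncard =
        2 * sumB k d := by
    filter_upwards [hgen] with ω hω
    have hfin : Module.finrank ℝ (EuclideanSpace ℝ (Fin d)) = d := finrank_euclideanSpace_fin
    have hblock : Generic (Module.finrank ℝ (EuclideanSpace ℝ (Fin d)))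
        (blockSum i fun j => ξ j ω) := hfin.symm ▸ hω.blockSum i
    simpa only [hfin] using hblock.ncard_setOf_walk_signedPerm_mem_hullAvoiding
  exact_mod_cast sum_measureReal_eq_of_ae_ncard_eq (fun g => (hmeas g).nullMeasurableSet) hcount

theorem sum_avoidProb [NeZero k] (hξ : ∀ i, Measurable (ξ i))
    (hEx : SymmExchangeable μ ξ) (hgen : ∀ᵐ ω ∂μ, Generic d fun j => ξ j ω) :
    (2 ^ k * k.factorial) * ∑ i : Fin k ↪o Fin n, avoidProb μ ξ i =
      n.choose k * (2 * sumB k d) :=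
  calc (2 ^ k * k.factorial) * ∑ i : Fin k ↪o Fin n, avoidProb μ ξ i
      = ∑ _g : SignedPerm k, ∑ i : Fin k ↪o Fin n, avoidProb μ ξ i := by
        rw [sum_const, card_univ, card_signedPerm, nsmul_eq_mul]
        push_cast
        rfl
    _ = ∑ g : SignedPerm k, ∑ i : Fin k ↪o Fin n, avoidProb μ ξ (permuteBlocks g.1 i) :=
        sum_congr rfl fun g _ => ((permuteBlocks_bijective g.1).sum_comp _).symm
    _ = ∑ _i : Fin k ↪o Fin n, (2 * sumB k d : ℝ) := by
        rw [sum_comm]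
        exact sum_congr rfl fun i _ => sum_avoidProb_permuteBlocks hξ hEx hgen i
    _ = n.choose k * (2 * sumB k d) := by
        rw [sum_const, card_univ, card_orderEmb, nsmul_eq_mul]

theorem integral_M [NeZero k] (hξ : ∀ i, Measurable (ξ i))
    (hEx : SymmExchangeable μ ξ) (hgen : ∀ᵐ ω ∂μ, Generic d fun j => ξ j ω) :
    ∫ ω, M k ξ ω ∂μ = n.choose k * (sumB k d / (2 ^ k * k.factorial)) := by
  rw [integral_M_eq_sum_avoidProb hξ, mul_div_assoc', eq_div_iff (by positivity)]
  linear_combination (1 / 2 : ℝ) * sum_avoidProb (k := k) hξ hEx hgen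

end Expectation

section OneDimensional

theorem zero_notMem_convexHull_line {s : Set (EuclideanSpace ℝ (Fin 1))} :
    0 ∉ convexHull ℝ s ↔ (∀ x ∈ s, 0 < x 0) ∨ ∀ x ∈ s, x 0 < 0 := by
  let c : EuclideanSpace ℝ (Fin 1) →ₗ[ℝ] ℝ := (EuclideanSpace.proj (0 : Fin 1)).toLinearMap
  constructor
  · intro h0
    have hne : ∀ x ∈ convexHull ℝ s, c x ≠ 0 := by
      rintro x hx hx0
      refine h0 ((?_ : x = 0) ▸ hx)
      ext i
      rwa [Subsingleton.elim i 0]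
    by_contra! hcon
    obtain ⟨⟨x, hxs, hx0⟩, ⟨y, hys, hy0⟩⟩ := hcon
    have hx := subset_convexHull ℝ s hxs
    have hy := subset_convexHull ℝ s hys
    have hcx : c x < 0 := lt_of_le_of_ne hx0 (hne x hx)
    have hcy : 0 < c y := lt_of_le_of_ne hy0 (hne y hy).symm
    have hsign := sign_eq_of_convex (convex_convexHull ℝ s) hne hx hy
    rw [sign_neg hcx, sign_pos hcy] at hsign
    exact absurd hsign (by decide)
  · rintro (h | h) h0
    · exact lt_irrefl (0 : ℝ) (convexHull_min h (convex_halfSpace_gt c.isLinear 0) h0)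
    · exact lt_irrefl (0 : ℝ) (convexHull_min h (convex_halfSpace_lt c.isLinear 0) h0)

variable {n k : ℕ}

theorem choose_numPos (y : Fin n → ℝ) :
    ((numPos y).choose k : ℝ) =
      ∑ I ∈ powersetCard k univ, if ∀ i ∈ I, 0 < y i then 1 else 0 := by
  classical
  rw [sum_boole, numPos, ← card_powersetCard]
  congr 2
  ext I
  simp only [mem_powersetCard, mem_filter, true_and, subset_iff, mem_univ]
  tauto

theorem halfCount_line [NeZero k] (x : Fin n → EuclideanSpace ℝ (Fin 1)) :
    halfCount k x = 1 / 2 *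
      ((numPos fun i => x i 0).choose k + (numPos fun i => (-x i) 0).choose k) := by
  classical
  rw [halfCount, choose_numPos, choose_numPos, ← sum_add_distrib]
  congr 1
  refine sum_congr rfl fun I hI => ?_
  obtain ⟨i, hi⟩ : I.Nonempty :=
    card_pos.1 ((mem_powersetCard.1 hI).2 ▸ Nat.pos_of_neZero k)
  simp only [zero_notMem_convexHull_line, Set.forall_mem_image, mem_coe, PiLp.neg_apply, neg_pos]
  have hexclusive : (∀ i ∈ I, 0 < x i 0) → ¬∀ i ∈ I, x i 0 < 0 :=
    fun hpos hneg => (hpos i hi).not_gt (hneg i hi)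
  split_ifs <;> first | tauto | norm_num

theorem walk_neg {V : Type*} [AddCommGroup V] (x : Fin n → V) :
    walk (fun j => -x j) = fun i => -walk x i := by
  funext i
  simp [walk]

theorem measurable_numPos : Measurable (numPos : (Fin n → ℝ) → ℕ) := by
  unfold numPos
  simp only [card_filter]
  refine Finset.measurable_sum _ fun i _ => ?_
  exact Measurable.ite (measurableSet_lt measurable_const (measurable_pi_apply i))
    measurable_const measurable_const

theorem measurable_choose_numPos_walk :
    Measurable fun x : Fin n → EuclideanSpace ℝ (Fin 1) =>
      ((numPos fun i => walk x i 0).choose k : ℝ) := by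
  have hcoord : Measurable fun (x : Fin n → EuclideanSpace ℝ (Fin 1)) i => walk x i 0 :=
    measurable_pi_iff.2 fun i => ((EuclideanSpace.proj (𝕜 := ℝ) (0 : Fin 1)).continuous.comp
      ((continuous_apply i).comp continuous_walk)).measurable
  have hchoose : Measurable fun m : ℕ => (m.choose k : ℝ) := measurable_from_top
  exact hchoose.comp (measurable_numPos.comp hcoord)

variable {Ω : Type*} [MeasurableSpace Ω] {μ : Measure Ω} [IsProbabilityMeasure μ]

theorem integrable_choose_numPos_walk {ζ : Ω → Fin n → EuclideanSpace ℝ (Fin 1)}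
    (hζ : Measurable ζ) :
    Integrable (fun ω => ((numPos fun i => walk (ζ ω) i 0).choose k : ℝ)) μ := by
  refine Integrable.of_bound (measurable_choose_numPos_walk.comp hζ).aestronglyMeasurable
    (n.choose k) (Filter.Eventually.of_forall fun ω => ?_)
  rw [Real.norm_natCast, Nat.cast_le]
  exact Nat.choose_le_choose k ((card_filter_le _ _).trans_eq (card_fin n))

/- The reflected walk has the same law, so the two halves of `halfCount_line` have equal means. -/
theorem integral_choose_numPos [NeZero k] {ξ : Fin n → Ω → EuclideanSpace ℝ (Fin 1)}
    (hξ : ∀ i, Measurable (ξ i)) (hEx : SymmExchangeable μ ξ) :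
    ∫ ω, ((numPos fun i => walk (fun j => ξ j ω) i 0).choose k : ℝ) ∂μ =
      ∫ ω, M k ξ ω ∂μ := by
  let F (x : Fin n → EuclideanSpace ℝ (Fin 1)) : ℝ := (numPos fun i => walk x i 0).choose k
  have hlaw : IdentDistrib (fun ω i => ξ i ω) (fun ω i => -ξ i ω) μ μ := by
    simpa using hEx 1 (fun _ => -1) fun _ => Or.inl rfl
  have hneg : ∫ ω, F (fun j => ξ j ω) ∂μ = ∫ ω, F (fun j => -ξ j ω) ∂μ :=
    (hlaw.comp measurable_choose_numPos_walk).integral_eq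
  have hM (ω : Ω) : M k ξ ω = 1 / 2 * (F (fun j => ξ j ω) + F (fun j => -ξ j ω)) := by
    simp only [M, halfCount_line, F, walk_neg]
  have hF : Integrable (fun ω => F fun j => ξ j ω) μ :=
    integrable_choose_numPos_walk (measurable_pi_iff.2 hξ)
  have hFneg : Integrable (fun ω => F fun j => -ξ j ω) μ :=
    integrable_choose_numPos_walk (measurable_pi_iff.2 fun i => (hξ i).neg)
  simp only [hM]
  rw [integral_const_mul, integral_add hF hFneg, ← hneg, ← two_mul, one_div,
    inv_mul_cancel_left₀ two_ne_zero]

end OneDimensional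

end ArcsineLaw

/-- In the second formula, `fun i : Fin k => ξ (Fin.castLE hkn i)` are the first `k` increments.
The last part is the one-dimensional case, stated for the number of positive terms. -/
theorem theorem1p2 {Ω : Type*} [MeasurableSpace Ω] (μ : MeasureTheory.Measure Ω)
    [MeasureTheory.IsProbabilityMeasure μ] (d n : ℕ) (hd : 1 ≤ d) (hn : d + 1 ≤ n)
    (ξ : Fin n → Ω → EuclideanSpace ℝ (Fin d)) (hξ : ∀ i, Measurable (ξ i))
    (hEx : ArcsineLaw.SymmExchangeable μ ξ) (hGP : ArcsineLaw.GeneralPosition μ ξ)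
    (k : ℕ) (hk : 1 ≤ k) (hkn : k ≤ n) :
    (∫ ω, ArcsineLaw.M k ξ ω ∂μ
        = (n.choose k : ℝ) * ((ArcsineLaw.sumB k d : ℝ) / (2 ^ k * (k.factorial : ℝ)))) ∧
    (∫ ω, ArcsineLaw.M k ξ ω ∂μ
        = (n.choose k : ℝ) *
          ∫ ω, ArcsineLaw.M k (fun i : Fin k => ξ (Fin.castLE hkn i)) ω ∂μ) ∧
    (d = 1 →
      ∫ ω, (((ArcsineLaw.numPos
          (fun i => ArcsineLaw.walk (fun j => ξ j ω) i ⟨0, hd⟩)).choose k : ℕ) : ℝ) ∂μ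
        = 1 / 2 ^ (2 * k) * ((2 * k).choose k : ℝ) * (n.choose k : ℝ)) := by
  have : NeZero k := ⟨by lia⟩
  have hgen := ArcsineLaw.ae_generic (by lia) hEx hGP
  have hM := ArcsineLaw.integral_M (k := k) hξ hEx hgen
  refine ⟨hM, ?_, ?_⟩
  · rw [hM, ArcsineLaw.integral_M (fun i => hξ _) (hEx.castLE hkn)
      (hgen.mono fun ω hω => hω.castLE hkn), Nat.choose_self, Nat.cast_one, one_mul]
  · rintro rfl
    calc _ = ∫ ω, ArcsineLaw.M k ξ ω ∂μ := ArcsineLaw.integral_choose_numPos hξ hEx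
      _ = _ := by rw [hM, ArcsineLaw.sumB_one_div, mul_comm]
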